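/- **Setting.** $E$ is a finite set and $F,F'$ are hyperfields (commutative, with reversible hyperaddition $\boxplus$) with involutions $x\mapsto\bar x$ (possibly trivial). $f:F\to F'$ is a homomorphism of hyperfields ($f(0)=0$, $f(1)=1$, $f(xy)=f(x)f(y)$, $f(x\boxplus y)\subseteq f(x)\boxplus f(y)$) that is compatible with the involutions: $f(\bar x)=\overline{f(x)}$; this is automatic when both involutions are trivial. For $X\in F^E$ put $\underline X=\{e: X(e)\ne0\}$, $f_*(X)=f\circ X$, and write $X\perp Y$ if $0\in\boxplus_{e\in E}X(e)\overline{Y(e)}$. A *weak $F$-matroid* $M$ on $E$ is given by its set of $F$-circuits $\mathcal C(M)\subseteq F^E$, subject to: (C0) $0\notin\mathcal C$; (C1) $\mathcal C$ is closed under multiplication by $F^\times$; (C2) if $X,Y\in\mathcal C$ and $\underline X\subseteq\underline Y$ then $X\in F^\times Y$; (C3)$'$ if $X,Y\in\mathcal C$, $\underline X,\underline Y$ is a modular pair in $\{\underline W:W\in\mathcal C\}$ (they are distinct and $\underline X\cup\underline Y$ does not properly contain a union of two distinct supports of members of $\mathcal C$) and $X(e)=-Y(e)\ne0$, then there is $Z\in\mathcal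 C$ with $Z(e)=0$ and $Z(g)\in X(g)\boxplus Y(g)$ for all $g\in E$. A *strong $F$-matroid* satisfies instead of (C3)$'$ the axiom (C3): if $X,X_1,\dots,X_k\in\mathcal C$, the join of their supports has height $k+1$ in the lattice of unions of supports of members of $\mathcal C$, $\underline X\not\subseteq\bigcup_i\underline X_i$, and $e_i\in(\underline X\cap\underline X_i)\setminus\bigcup_{j\ne i}\underline X_j$ with $X(e_i)=-X_i(e_i)$ for $1\le i\le k$, then there is $Z\in\mathcal C$ with $Z(e_i)=0$ for all $i$ and $Z(g)\in X(g)\boxplus X_1(g)\boxplus\cdots\boxplus X_k(g)$ for all $g\in E$. The *underlying matroid* of $M$ is the matroid on $E$ whose circuits are the sets $\underline X$, $X\in\mathcal C(M)$. The *$F$-cocircuits* of a strong $F$-matroid $M$ are the elements of minimal support among the non-zero $Y\in F^E$ with $Y\perp X$ for all $X\in\mathcal C(M)$. The *$F$-cocircuits* of a weak $F$-matroid $M$ are the $Y\in F^E$ such that $\underline Y$ is a cocircuit of the underlying matroid and $X\perp Y$ for all $X\in\mathcal C(M)$ with $|\underline X\cap\underline Y|\le3$. The *dual* $M^*$ is the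 strong (resp. weak) $F$-matroid whose $F$-circuits are the $F$-cocircuits of $M$. For $r\ge0$, a *Grassmann–Plücker function* of rank $r$ is a not identically zero, alternating function $\varphi:E^r\to F$ such that $$0\in\boxplus_{k=1}^{r+1}(-1)^k\varphi(x_1,\dots,\hat x_k,\dots,x_{r+1})\,\varphi(x_k,y_1,\dots,y_{r-1})$$ for all $x_1,\dots,x_{r+1},y_1,\dots,y_{r-1}\in E$ (no condition if $r=0$). For a *weak Grassmann–Plücker function* the relation is required only if $|\{x_1,\dots,x_{r+1}\}\setminus\{y_1,\dots,y_{r-1}\}|=3$, and the sets $\{x_1,\dots,x_r\}$ with $\varphi(x_1,\dots,x_r)\neq0$ have to be the bases of a matroid on $E$. $\varphi$ is *a (weak) Grassmann–Plücker function of $M$* if it is a Grassmann–Plücker function (resp. weak Grassmann–Plücker function) and $\mathcal C(M)$ is the set of all $X\in F^E$ such that $\underline X$ is a circuit of the matroid $M_\varphi$ whose bases are the $\{x_1,\dots,x_r\}$ with $\varphi(x_1,\dots,x_r)\ne0$, and $$\frac{X(x_i)}{X(x_0)}=(-1)^i\frac{\varphi(x_0,\dots,\hat x_i,\dots,x_r)}{\varphi(x_1,\dots,x_r)}\qquad(0\le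 i\le r)$$ whenever $x_0\in\underline X$ and $\{x_1,\dots,x_r\}$ is a basis of $M_\varphi$ containing $\underline X\setminus\{x_0\}$. **Corollary 4.8.** Let $M$ be a strong (resp. weak) $F$-matroid on $E$. Then there is a strong (resp. weak) $F'$-matroid $f_*(M)$ on $E$ which is 1. the unique strong (resp. weak) $F'$-matroid whose set of $F'$-circuits is $\{c'f_*(X): c'\in F'\setminus\{0\},\ X\in\mathcal C(M)\}$; 2. the unique strong (resp. weak) $F'$-matroid whose set of $F'$-cocircuits is $\{c'f_*(Y): c'\in F'\setminus\{0\},\ Y \text{ an } F\text{-cocircuit of } M\}$; 3. for every $r$ and every Grassmann–Plücker function (resp. weak Grassmann–Plücker function) $\varphi:E^r\to F$ of $M$, the unique strong (resp. weak) $F'$-matroid of which $f\circ\varphi$ is a Grassmann–Plücker function (resp. weak Grassmann–Plücker function); in particular $f\circ\varphi$ is such a function. Moreover, $M^*$ and $f_*(M)^*$ exist as strong (resp. weak) matroids, and $f_*(M)^*=f_*(M^*)$. -/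

import Mathlib

/-! ### Hyperfields -/

/-- A (commutative) hyperfield: the multiplicative structure is that of a commutative group with
an absorbing zero adjoined (`0 ≠ 1`, all non-zero elements invertible), and `hadd` is a commutative,
associative, multivalued addition making it a canonical (reversible) hypergroup with neutral
element `0` and hyperinverse `-x`, over which multiplication distributes. -/
class Hyperfield (F : Type*) extends CommGroupWithZero F, Neg F where
  /-- The hyperaddition `x ⊞ y`. -/
  hadd : F → F → Set F
  hadd_nonempty : ∀ x y, (hadd x y).Nonempty
  hadd_comm : ∀ x y, hadd x y = hadd y x
  hadd_assoc : ∀ x y z, (⋃ t ∈ hadd y z, hadd x t) = ⋃ t ∈ hadd x y, hadd t z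
  zero_hadd : ∀ x, hadd 0 x = {x}
  zero_mem_hadd_iff : ∀ x y, (0 : F) ∈ hadd x y ↔ y = -x
  reversible : ∀ x y z, x ∈ hadd y z ↔ z ∈ hadd x (-y)
  mul_hadd : ∀ a x y, (fun t => a * t) '' hadd x y = hadd (a * x) (a * y)

namespace Hyperfield

/-- Adding an element to a set: `x ⊞ S = ⋃_{y ∈ S} x ⊞ y`. -/
def haddSet {F : Type*} [Hyperfield F] (x : F) (S : Set F) : Set F :=
  ⋃ y ∈ S, hadd x y

instance haddSet_leftCommutative {F : Type*} [Hyperfield F] :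
    LeftCommutative (haddSet : F → Set F → Set F) where
  left_comm x y S := by
    have key : ∀ a b s : F, haddSet a (hadd b s) = haddSet b (hadd a s) := by
      intro a b s
      unfold haddSet
      rw [hadd_assoc a b s, hadd_assoc b a s, hadd_comm a b]
    have expand : ∀ a b : F, haddSet a (haddSet b S) = ⋃ s ∈ S, haddSet a (hadd b s) := by
      intro a b
      ext z
      simp only [haddSet, Set.mem_iUnion, exists_prop]
      constructor
      · rintro ⟨t, ⟨s, hs, ht⟩, hz⟩
        exact ⟨s, hs, t, ht, hz⟩
      · rintro ⟨s, hs, t, ht, hz⟩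
        exact ⟨t, ⟨s, hs, ht⟩, hz⟩
    rw [expand x y, expand y x]
    simp only [key x y]

/-- The hypersum `x₁ ⊞ (x₂ ⊞ ⋯)` of a finite family. It does not depend on the order of the
terms; the hypersum of one element `x` is `{x}`, and the empty hypersum is `{0}`. -/
def hypersum {F ι : Type*} [Hyperfield F] [Fintype ι] (g : ι → F) : Set F :=
  (Finset.univ.val.map g).foldr haddSet {0}

end Hyperfield

/-- A homomorphism of hyperfields. -/
structure HyperfieldHom (F F' : Type*) [Hyperfield F] [Hyperfield F'] extends F →*₀ F' where
  map_hadd : ∀ x y,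
    toFun '' Hyperfield.hadd x y ⊆ Hyperfield.hadd (toFun x) (toFun y)

/-- An involution of a hyperfield. -/
structure HyperfieldInvolution (F : Type*) [Hyperfield F] extends F →*₀ F where
  map_hadd : ∀ x y,
    toFun '' Hyperfield.hadd x y = Hyperfield.hadd (toFun x) (toFun y)
  invol : ∀ x, toFun (toFun x) = x

namespace HyperfieldMatroid

open Function Hyperfield

/-! ### Supports, modular pairs and modular families -/

/-- The collection of supports of the elements of `C ⊆ F^E`. -/
def supports {F E : Type*} [Zero F] (C : Set (E → F)) : Set (Set E) :=
  support '' C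

/-- Two members of a collection of sets form a modular pair if they are distinct and their union
does not properly contain a union of two distinct members. -/
def IsModularPair {E : Type*} (S : Set (Set E)) (A B : Set E) : Prop :=
  A ∈ S ∧ B ∈ S ∧ A ≠ B ∧
    ¬ ∃ A' ∈ S, ∃ B' ∈ S, A' ≠ B' ∧ A' ∪ B' ⊂ A ∪ B

/-- The lattice of all unions of members of `S`, ordered by inclusion. -/
def unionLattice {E : Type*} (S : Set (Set E)) : Set (Set E) :=
  {A | ∃ T ⊆ S, A = ⋃₀ T}

theorem iUnion_mem_unionLattice {E ι : Type*} {S : Set (Set E)} {A : ι → Set E}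
    (hA : ∀ i, A i ∈ S) : (⋃ i, A i) ∈ unionLattice S :=
  ⟨Set.range A, by rintro _ ⟨i, rfl⟩; exact hA i, by rw [Set.sUnion_range]⟩

/-- A family of `n` members of `S` is modular if the height of its join in the lattice of unions
of members of `S` is `n`. -/
def IsModularFamily {E : Type*} (S : Set (Set E)) {n : ℕ} (A : Fin n → Set E) : Prop :=
  ∃ hA : ∀ i, A i ∈ S,
    Order.height (⟨⋃ i, A i, iUnion_mem_unionLattice hA⟩ : unionLattice S) = (n : ℕ∞)

/-! ### Strong and weak matroids over a hyperfield, through their circuits -/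

/-- The axioms common to circuit sets of strong and of weak matroids. -/
structure IsPreCircuitSet {F E : Type*} [Hyperfield F] (C : Set (E → F)) : Prop where
  zero_notMem : (fun _ => (0 : F)) ∉ C
  smul_mem : ∀ X ∈ C, ∀ a : F, a ≠ 0 → (fun e => a * X e) ∈ C
  incomparable : ∀ X ∈ C, ∀ Y ∈ C, support X ⊆ support Y →
    ∃ a : F, a ≠ 0 ∧ X = fun e => a * Y e

/-- Circuit sets of weak matroids: modular elimination. -/
structure IsWeakCircuitSet {F E : Type*} [Hyperfield F] (C : Set (E → F)) : Prop
    extends IsPreCircuitSet C where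
  modular_elimination : ∀ X ∈ C, ∀ Y ∈ C,
    IsModularPair (supports C) (support X) (support Y) →
    ∀ e, X e = -Y e → X e ≠ 0 →
      ∃ Z ∈ C, Z e = 0 ∧ ∀ g, Z g ∈ hadd (X g) (Y g)

/-- Circuit sets of strong matroids: strong modular elimination. The modular family consists of
`X 0` (the distinguished circuit) and `X 1, …, X k`. -/
structure IsStrongCircuitSet {F E : Type*} [Hyperfield F] (C : Set (E → F)) : Prop
    extends IsPreCircuitSet C where
  strong_modular_elimination : ∀ (k : ℕ) (X : Fin (k + 1) → E → F), (∀ i, X i ∈ C) →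
    IsModularFamily (supports C) (fun i => support (X i)) →
    ¬ support (X 0) ⊆ ⋃ i : Fin k, support (X i.succ) →
    ∀ e : Fin k → E,
      (∀ i, X 0 (e i) = -X i.succ (e i) ∧ X 0 (e i) ≠ 0) →
      (∀ i j, j ≠ i → e i ∉ support (X j.succ)) →
      ∃ Z ∈ C, (∀ i, Z (e i) = 0) ∧ ∀ g, Z g ∈ hypersum (fun i => X i g)

/-- A strong `F`-matroid on `E`, given by its set of `F`-circuits. -/
@[ext] structure StrongMatroid (F E : Type*) [Hyperfield F] where
  circuits : Set (E → F)
  isCircuitSet : IsStrongCircuitSet circuits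

/-- A weak `F`-matroid on `E`, given by its set of `F`-circuits. -/
@[ext] structure WeakMatroid (F E : Type*) [Hyperfield F] where
  circuits : Set (E → F)
  isCircuitSet : IsWeakCircuitSet circuits

/-! ### Duality -/

/-- `X ⊥ Y`: zero lies in the inner product `⊞ₑ X(e) · τ(Y(e))`. -/
def Orthogonal {F E : Type*} [Hyperfield F] [Fintype E] (τ : HyperfieldInvolution F)
    (X Y : E → F) : Prop :=
  (0 : F) ∈ hypersum (fun e => X e * τ.toFun (Y e))

/-- The orthogonal complement `S^⊥`. -/
def orthogonalComplement {F E : Type*} [Hyperfield F] [Fintype E] (τ : HyperfieldInvolution F)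
    (S : Set (E → F)) : Set (E → F) :=
  {X | ∀ Y ∈ S, Orthogonal τ X Y}

/-- The elements of `S` of minimal support. -/
def suppMin {F E : Type*} [Zero F] (S : Set (E → F)) : Set (E → F) :=
  {X | X ∈ S ∧ ∀ Y ∈ S, support Y ⊆ support X → support Y = support X}

/-- The cocircuits of a strong matroid: the non-zero vectors of minimal support that are
orthogonal to all circuits. -/
def StrongMatroid.cocircuits {F E : Type*} [Hyperfield F] [Fintype E]
    (τ : HyperfieldInvolution F) (M : StrongMatroid F E) : Set (E → F) :=
  suppMin (orthogonalComplement τ M.circuits \ {fun _ => 0})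

/-- `U` is the underlying matroid of an `F`-matroid with circuit set `C`: the matroid on `E` whose
circuits are the supports of the members of `C`. -/
def IsUnderlyingMatroid {F E : Type*} [Hyperfield F] (U : Matroid E) (C : Set (E → F)) : Prop :=
  U.E = Set.univ ∧ ∀ A : Set E, U.IsCircuit A ↔ A ∈ supports C

/-- The cocircuits of a weak matroid: the vectors supported on cocircuits of the underlying
matroid that are orthogonal to every circuit whose support meets theirs in at most three elements.
This is the signature of the dual of the underlying matroid that forms a weak dual pair with the
circuits. (A weak matroid need not have enough vectors orthogonal to *all* its circuits.) -/
def WeakMatroid.cocircuits {F E : Type*} [Hyperfield F] [Fintype E]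
    (τ : HyperfieldInvolution F) (M : WeakMatroid F E) : Set (E → F) :=
  {Y | (∃ U : Matroid E, IsUnderlyingMatroid U M.circuits ∧ U.IsCocircuit (support Y)) ∧
    ∀ X ∈ M.circuits, (support X ∩ support Y).ncard ≤ 3 → Orthogonal τ X Y}

/-- `M'` is the dual of the strong matroid `M`. -/
def StrongMatroid.IsDual {F E : Type*} [Hyperfield F] [Fintype E]
    (τ : HyperfieldInvolution F) (M M' : StrongMatroid F E) : Prop :=
  M'.circuits = M.cocircuits τ

/-- `M'` is the dual of the weak matroid `M`. -/
def WeakMatroid.IsDual {F E : Type*} [Hyperfield F] [Fintype E]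
    (τ : HyperfieldInvolution F) (M M' : WeakMatroid F E) : Prop :=
  M'.circuits = M.cocircuits τ

/-! ### Grassmann-Plücker functions -/

/-- The sets `{x₁, …, x_r}` with `φ(x₁, …, x_r) ≠ 0`. -/
def gpBases {F E : Type*} [Zero F] {r : ℕ} (φ : (Fin r → E) → F) : Set (Set E) :=
  {B | ∃ x : Fin r → E, φ x ≠ 0 ∧ Set.range x = B}

/-- `φ` is not identically zero, and alternating. -/
structure IsAlternatingNonzero {F E : Type*} [Hyperfield F] {r : ℕ}
    (φ : (Fin r → E) → F) : Prop where
  nonzero : ∃ x, φ x ≠ 0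
  swap : ∀ (x : Fin r → E) (i j : Fin r), i ≠ j → φ (x ∘ Equiv.swap i j) = -φ x
  eq_zero : ∀ (x : Fin r → E) (i j : Fin r), i ≠ j → x i = x j → φ x = 0

/-- The Grassmann-Plücker relation of `φ` for the tuples `(x₁, …, x_{r+1})` and
`(y₁, …, y_{r-1})`, where `r = s + 1`. Indices of tuples start at `0` here. -/
def GPRelation {F E : Type*} [Hyperfield F] {r s : ℕ} (h : r = s + 1)
    (φ : (Fin r → E) → F) (x : Fin (r + 1) → E) (y : Fin s → E) : Prop :=
  (0 : F) ∈ hypersum (fun k : Fin (r + 1) =>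
    (-1 : F) ^ ((k : ℕ) + 1) * φ (fun i => x (k.succAbove i)) *
      φ (fun i => (Fin.cons (x k) y : Fin (s + 1) → E) (Fin.cast h i)))

/-- (Strong) Grassmann-Plücker functions of rank `r`. For `r = 0` there are no relations. -/
structure IsStrongGP {F E : Type*} [Hyperfield F] {r : ℕ} (φ : (Fin r → E) → F) : Prop
    extends IsAlternatingNonzero φ where
  relation : ∀ (s : ℕ) (h : r = s + 1) (x : Fin (r + 1) → E) (y : Fin s → E),
    GPRelation h φ x y

/-- Weak Grassmann-Plücker functions of rank `r`: the support is the set of bases of a matroid on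
`E`, and the three-term relations hold. -/
structure IsWeakGP {F E : Type*} [Hyperfield F] {r : ℕ} (φ : (Fin r → E) → F) : Prop
    extends IsAlternatingNonzero φ where
  bases : ∃ U : Matroid E, U.E = Set.univ ∧ ∀ B, U.IsBase B ↔ B ∈ gpBases φ
  relation : ∀ (s : ℕ) (h : r = s + 1) (x : Fin (r + 1) → E) (y : Fin s → E),
    (Set.range x \ Set.range y).ncard = 3 → GPRelation h φ x y

/-- The set of `F`-circuits attached to `φ`: vectors `X` whose support is a circuit of the matroid
with bases `gpBases φ` (a minimal set not contained in a basis), such that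
`X(x_i) / X(x_0) = (-1)^i φ(x_0, …, x̂_i, …, x_r) / φ(x_1, …, x_r)` whenever `x_0` lies in the
support and `{x_1, …, x_r}` is a basis containing the rest of the support. -/
def gpCircuits {F E : Type*} [Hyperfield F] {r : ℕ} (φ : (Fin r → E) → F) : Set (E → F) :=
  {X | Minimal (fun A : Set E => ∀ B ∈ gpBases φ, ¬ A ⊆ B) (support X) ∧
    ∀ x : Fin (r + 1) → E, x 0 ∈ support X →
      φ (fun i => x i.succ) ≠ 0 →
      support X \ {x 0} ⊆ Set.range (fun i : Fin r => x i.succ) →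
      ∀ i : Fin (r + 1),
        X (x i) / X (x 0) =
          (-1 : F) ^ (i : ℕ) * (φ (fun j => x (i.succAbove j)) / φ (fun j => x j.succ))}

/-- `φ` is a Grassmann-Plücker function of the strong matroid `M`. -/
def StrongMatroid.HasGP {F E : Type*} [Hyperfield F] (M : StrongMatroid F E) {r : ℕ}
    (φ : (Fin r → E) → F) : Prop :=
  IsStrongGP φ ∧ M.circuits = gpCircuits φ

/-- `φ` is a weak Grassmann-Plücker function of the weak matroid `M`. -/
def WeakMatroid.HasGP {F E : Type*} [Hyperfield F] (M : WeakMatroid F E) {r : ℕ}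
    (φ : (Fin r → E) → F) : Prop :=
  IsWeakGP φ ∧ M.circuits = gpCircuits φ

/-! ### Push-forward -/

/-- The rescaled images `{c' f_*(X) : c' ≠ 0, X ∈ C}`. -/
def pushSet {F F' E : Type*} [Hyperfield F] [Hyperfield F'] (f : HyperfieldHom F F')
    (C : Set (E → F)) : Set (E → F') :=
  {Z | ∃ c : F', c ≠ 0 ∧ ∃ X ∈ C, Z = fun e => c * f.toFun (X e)}

end HyperfieldMatroid

/-! Matroids of both kinds can be described by orthogonality alone, in a form that is visibly
preserved by `f` and symmetric under duality. Call signatures `C` of a matroid `U` and `D` of its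
dual an `n`-dual pair if `X ⊥ Y` whenever the supports of `X ∈ C` and `Y ∈ D` meet in at most `n`
elements (`IsDualPair`). Weak matroids are the case `n = 3`, strong ones the case `n = ⊤`.

Elimination gives duality. Circuits meeting a cocircuit `K` in exactly two elements determine a
vector on `K` up to scaling (`exists_orthogonal_of_isCocircuit`), and eliminating `k` elements
yields orthogonality for intersections of size `k + 2` (`orthogonal_of_hasElimination`). Conversely,
orthogonality up to size `k + 2` yields elimination of `k` elements
(`hasElimination_of_orthogonal`). Modularity is handled throughout by the nullity of the union of
the supports.

A homomorphism keeps supports and sends a hypersum containing `0` to one containing `0`, so it maps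
dual pairs to dual pairs (`IsDualPair.map`). This gives the matroid `f_*(M)` and its dual at once.
Each half of a dual pair determines the other (`right_unique`, `left_unique`), hence the uniqueness
statement for cocircuits.

Grassmann–Plücker relations are likewise preserved by `f`. It remains to see that the circuits
attached to `f ∘ φ` are the rescaled images of those attached to `φ` (`gpCircuits_map`). For this
every matroid circuit must carry a vector of `gpCircuits φ`, which follows from the three-term
relations (`IsWeakGP.exists_vector`). -/

section

open Function Set

/-! ### Hyperaddition of sets and hypersums -/

namespace Hyperfield

/-- Subsets of a hyperfield, with their elementwise hyperaddition. -/
def HyperSet (F : Type*) := Set F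

namespace HyperSet

/-- The underlying set. -/
def toSet {F : Type*} (S : HyperSet F) : Set F := S

/-- A singleton. -/
def single {F : Type*} (x : F) : HyperSet F := ({x} : Set F)

theorem mem_single {F : Type*} {x y : F} : x ∈ (single y).toSet ↔ x = y := Iff.rfl

theorem ext {F : Type*} {S T : HyperSet F} (h : ∀ z, z ∈ S.toSet ↔ z ∈ T.toSet) : S = T :=
  Set.ext h

end HyperSet

section Basic

variable {F : Type*} [Hyperfield F]

/-- Multiplying `0 ∈ 1 ⊞ (-1)` by `x` exhibits `x * -1` as the unique hyperinverse of `x`. -/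
theorem neg_one_mul_self_eq (x : F) : x * -1 = -x := by
  have h : (0 : F) ∈ hadd 1 (-1) := (zero_mem_hadd_iff _ _).2 rfl
  have h' : x * 0 ∈ (fun t => x * t) '' hadd 1 (-1) := ⟨0, h, rfl⟩
  rw [mul_hadd, mul_zero, mul_one] at h'
  exact (zero_mem_hadd_iff _ _).1 h'

theorem neg_neg_self (x : F) : - -x = x := by
  have h : (0 : F) ∈ hadd x (-x) := (zero_mem_hadd_iff _ _).2 rfl
  rw [hadd_comm] at h
  exact ((zero_mem_hadd_iff _ _).1 h).symm

instance instHasDistribNeg : HasDistribNeg F where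
  neg_neg := neg_neg_self
  neg_mul x y := by
    rw [← neg_one_mul_self_eq, ← neg_one_mul_self_eq (x * y), mul_right_comm]
  mul_neg x y := by
    rw [← neg_one_mul_self_eq, ← neg_one_mul_self_eq (x * y), mul_assoc]

theorem neg_zero_eq : -(0 : F) = 0 := by
  rw [← neg_one_mul_self_eq, zero_mul]

theorem neg_eq_zero_iff' {x : F} : -x = 0 ↔ x = 0 := by
  constructor
  · intro h
    rw [← neg_neg x, h, neg_zero_eq]
  · rintro rfl
    exact neg_zero_eq

theorem hadd_zero (x : F) : hadd x 0 = {x} := by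
  rw [hadd_comm, zero_hadd]

namespace HyperSet

instance : Zero (HyperSet F) := ⟨single 0⟩

instance : Add (HyperSet F) := ⟨fun S T => {z : F | ∃ x ∈ S.toSet, ∃ y ∈ T.toSet, z ∈ hadd x y}⟩

theorem mem_zero_iff {x : F} : x ∈ (0 : HyperSet F).toSet ↔ x = 0 := Iff.rfl

theorem mem_add {S T : HyperSet F} {z : F} :
    z ∈ (S + T).toSet ↔ ∃ x ∈ S.toSet, ∃ y ∈ T.toSet, z ∈ hadd x y := Iff.rfl

theorem mem_hadd_assoc {x y z w : F} :
    (∃ t ∈ hadd y z, w ∈ hadd x t) ↔ ∃ t ∈ hadd x y, w ∈ hadd t z := by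
  have h := Set.ext_iff.1 (hadd_assoc x y z) w
  simpa using h

/-- On sets the multivalued addition becomes a genuine operation, so hypersums turn into `Finset`
sums of singletons and can be split, reindexed and stripped of zeros. -/
instance : AddCommMonoid (HyperSet F) where
  add_assoc S T R := by
    refine ext fun w => ?_
    simp only [mem_add]
    constructor
    · rintro ⟨t, ⟨x, hx, y, hy, ht⟩, z, hz, hw⟩
      obtain ⟨s, hs, hw'⟩ := mem_hadd_assoc.2 ⟨t, ht, hw⟩
      exact ⟨x, hx, s, ⟨y, hy, z, hz, hs⟩, hw'⟩
    · rintro ⟨x, hx, t, ⟨y, hy, z, hz, ht⟩, hw⟩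
      obtain ⟨s, hs, hw'⟩ := mem_hadd_assoc.1 ⟨t, ht, hw⟩
      exact ⟨s, ⟨x, hx, y, hy, hs⟩, z, hz, hw'⟩
  zero_add S := by
    refine ext fun w => ?_
    simp only [mem_add, mem_zero_iff, exists_eq_left, zero_hadd, mem_singleton_iff, exists_eq_right']
  add_zero S := by
    refine ext fun w => ?_
    simp only [mem_add, mem_zero_iff, exists_eq_left, hadd_zero, mem_singleton_iff, exists_eq_right']
  add_comm S T := by
    refine ext fun w => ?_
    simp only [mem_add]
    constructor
    · rintro ⟨x, hx, y, hy, h⟩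
      exact ⟨y, hy, x, hx, hadd_comm x y ▸ h⟩
    · rintro ⟨x, hx, y, hy, h⟩
      exact ⟨y, hy, x, hx, hadd_comm x y ▸ h⟩
  nsmul := nsmulRec

theorem single_zero : single (0 : F) = 0 := rfl

theorem mem_single_add {S : HyperSet F} {x z : F} :
    z ∈ (single x + S).toSet ↔ ∃ y ∈ S.toSet, z ∈ hadd x y := by
  simp [mem_add, mem_single]

theorem zero_mem_single_add {S : HyperSet F} {x : F} :
    (0 : F) ∈ (single x + S).toSet ↔ -x ∈ S.toSet := by
  simp [mem_single_add, zero_mem_hadd_iff]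

theorem toSet_add_single (x y : F) : (single x + single y).toSet = hadd x y := by
  ext z
  simp [mem_single_add, mem_single]

end HyperSet

open HyperSet

theorem hypersum_eq_sum {ι : Type*} [Fintype ι] (g : ι → F) :
    hypersum g = (∑ i, single (g i)).toSet := by
  have key : ∀ m : Multiset ι,
      (m.map g).foldr haddSet {0} = ((m.map fun i => single (g i)).sum).toSet := by
    intro m
    induction m using Multiset.induction with
    | empty => rfl
    | cons a m ih =>
      rw [Multiset.map_cons, Multiset.foldr_cons, Multiset.map_cons, Multiset.sum_cons, ih]
      ext z
      simp [mem_single_add, haddSet]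
  exact key _

end Basic

section Map

open HyperSet

variable {F F' : Type*} [Hyperfield F] [Hyperfield F']

/-- The assumptions on `h` are weak enough to cover homomorphisms, involutions and multiplication by
a scalar. -/
theorem map_mem_sum {ι : Type*} {h : F → F'} (h0 : h 0 = 0)
    (hadd_le : ∀ x y, h '' hadd x y ⊆ hadd (h x) (h y)) (s : Finset ι) (g : ι → F) {z : F}
    (hz : z ∈ (∑ i ∈ s, single (g i)).toSet) : h z ∈ (∑ i ∈ s, single (h (g i))).toSet := by
  classical
  induction s using Finset.induction generalizing z with
  | empty =>
    rw [Finset.sum_empty, mem_zero_iff] at hz ⊢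
    rw [hz, h0]
  | insert a s ha ih =>
    rw [Finset.sum_insert ha, mem_single_add] at hz ⊢
    obtain ⟨y, hy, hzy⟩ := hz
    exact ⟨h y, ih hy, hadd_le _ _ ⟨z, hzy, rfl⟩⟩

theorem map_mem_hypersum {ι : Type*} [Fintype ι] {h : F → F'} (h0 : h 0 = 0)
    (hadd_le : ∀ x y, h '' hadd x y ⊆ hadd (h x) (h y)) {g : ι → F} {z : F}
    (hz : z ∈ hypersum g) : h z ∈ hypersum fun i => h (g i) := by
  rw [hypersum_eq_sum] at hz ⊢
  exact map_mem_sum h0 hadd_le _ _ hz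

theorem mul_mem_hypersum {ι : Type*} [Fintype ι] {g : ι → F} {z : F} (a : F)
    (hz : z ∈ hypersum g) : a * z ∈ hypersum fun i => a * g i :=
  map_mem_hypersum (h := fun t => a * t) (mul_zero a) (fun x y => (mul_hadd a x y).subset) hz

theorem mul_mem_sum {ι : Type*} {s : Finset ι} {g : ι → F} {z : F} (a : F)
    (hz : z ∈ (∑ i ∈ s, single (g i)).toSet) : a * z ∈ (∑ i ∈ s, single (a * g i)).toSet :=
  map_mem_sum (h := fun t => a * t) (mul_zero a) (fun x y => (mul_hadd a x y).subset) s g hz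

theorem map_neg_of_hadd {h : F →*₀ F'} (hadd_le : ∀ x y, h '' hadd x y ⊆ hadd (h x) (h y)) (x : F) :
    h (-x) = -h x := by
  have h0 : (0 : F) ∈ hadd x (-x) := (zero_mem_hadd_iff _ _).2 rfl
  have := hadd_le _ _ ⟨0, h0, rfl⟩
  rw [map_zero] at this
  exact (zero_mem_hadd_iff _ _).1 this

end Map

end Hyperfield

/-! ### Homomorphisms and involutions -/

namespace HyperfieldHom

variable {F F' : Type*} [Hyperfield F] [Hyperfield F'] (f : HyperfieldHom F F')

theorem toFun_zero : f.toFun 0 = 0 := map_zero f.toMonoidWithZeroHom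
theorem toFun_one : f.toFun 1 = 1 := map_one f.toMonoidWithZeroHom
theorem toFun_mul (x y : F) : f.toFun (x * y) = f.toFun x * f.toFun y :=
  map_mul f.toMonoidWithZeroHom x y
theorem toFun_div (x y : F) : f.toFun (x / y) = f.toFun x / f.toFun y :=
  map_div₀ f.toMonoidWithZeroHom x y
theorem toFun_neg (x : F) : f.toFun (-x) = -f.toFun x :=
  Hyperfield.map_neg_of_hadd (h := f.toMonoidWithZeroHom) f.map_hadd x
theorem toFun_eq_zero {x : F} : f.toFun x = 0 ↔ x = 0 := map_eq_zero f.toMonoidWithZeroHom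
theorem toFun_neg_one_pow (n : ℕ) : f.toFun ((-1) ^ n) = (-1) ^ n := by
  have h : f.toFun ((-1) ^ n) = (f.toFun (-1)) ^ n := map_pow f.toMonoidWithZeroHom _ _
  rw [h, toFun_neg, toFun_one]

theorem map_mem_hypersum {ι : Type*} [Fintype ι] {g : ι → F} {z : F}
    (hz : z ∈ Hyperfield.hypersum g) : f.toFun z ∈ Hyperfield.hypersum fun i => f.toFun (g i) :=
  Hyperfield.map_mem_hypersum f.toFun_zero f.map_hadd hz

theorem support_comp {E : Type*} (X : E → F) : support (fun e => f.toFun (X e)) = support X := by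
  ext e
  simp

end HyperfieldHom

namespace HyperfieldInvolution

variable {F : Type*} [Hyperfield F] (τ : HyperfieldInvolution F)

theorem toFun_zero : τ.toFun 0 = 0 := map_zero τ.toMonoidWithZeroHom
theorem toFun_mul (x y : F) : τ.toFun (x * y) = τ.toFun x * τ.toFun y :=
  map_mul τ.toMonoidWithZeroHom x y
theorem toFun_eq_zero {x : F} : τ.toFun x = 0 ↔ x = 0 := map_eq_zero τ.toMonoidWithZeroHom

end HyperfieldInvolution

namespace HyperfieldMatroid

open Hyperfield HyperSet

variable {F E : Type*} [Hyperfield F]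

theorem support_const_mul {a : F} (ha : a ≠ 0) (X : E → F) :
    support (fun e => a * X e) = support X := by
  ext e
  simp [ha]

/-! ### Orthogonality -/

section Orthogonal

variable [Fintype E] {τ : HyperfieldInvolution F} {X Y : E → F}

/-- Apply `τ` to the inner product and use that it is an involution. -/
theorem Orthogonal.symm (h : Orthogonal τ X Y) : Orthogonal τ Y X := by
  have h' := Hyperfield.map_mem_hypersum τ.toFun_zero (fun x y => (τ.map_hadd x y).subset) h
  rw [τ.toFun_zero] at h'
  unfold Orthogonal
  convert h' using 2
  funext e
  rw [τ.toFun_mul, τ.invol, mul_comm]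

theorem Orthogonal.const_mul_left (h : Orthogonal τ X Y) (a : F) :
    Orthogonal τ (fun e => a * X e) Y := by
  have h' := mul_mem_hypersum a h
  rw [mul_zero] at h'
  unfold Orthogonal
  convert h' using 2
  funext e
  rw [mul_assoc]

theorem Orthogonal.const_mul_right (h : Orthogonal τ X Y) (a : F) :
    Orthogonal τ X (fun e => a * Y e) :=
  (h.symm.const_mul_left a).symm

theorem orthogonal_iff_sum {s : Finset E} (hs : support X ∩ support Y ⊆ s) :
    Orthogonal τ X Y ↔ (0 : F) ∈ (∑ e ∈ s, single (X e * τ.toFun (Y e))).toSet := by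
  unfold Orthogonal
  rw [hypersum_eq_sum, Finset.sum_subset (Finset.subset_univ s)]
  intro e _ he
  have he' : ¬ (X e ≠ 0 ∧ Y e ≠ 0) := fun h => he (hs h)
  have : X e * τ.toFun (Y e) = 0 := by
    rw [mul_eq_zero, τ.toFun_eq_zero]
    tauto
  rw [this, single_zero]

theorem orthogonal_of_disjoint (h : support X ∩ support Y = ∅) : Orthogonal τ X Y := by
  rw [orthogonal_iff_sum (s := ∅) (by simp [h]), Finset.sum_empty, mem_zero_iff]

/-- With two terms, `0 ∈ x ⊞ y` forces `y = -x`: here orthogonality is an honest equation. Longer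
intersections are reduced to this case. -/
theorem orthogonal_iff_of_inter_subset_pair {e f : E} (hef : e ≠ f)
    (h : support X ∩ support Y ⊆ {e, f}) :
    Orthogonal τ X Y ↔ X f * τ.toFun (Y f) = -(X e * τ.toFun (Y e)) := by
  classical
  rw [orthogonal_iff_sum (s := {e, f}) (by simpa using h), Finset.sum_pair hef,
    toSet_add_single, zero_mem_hadd_iff]

theorem Orthogonal.inter_ne_singleton (h : Orthogonal τ X Y) (e : E) :
    support X ∩ support Y ≠ {e} := by
  intro he
  rw [orthogonal_iff_sum (s := {e}) (by simp [he]), Finset.sum_singleton, mem_single] at h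
  have : e ∈ support X ∩ support Y := he ▸ mem_singleton e
  have h' := h.symm
  rw [mul_eq_zero, τ.toFun_eq_zero] at h'
  exact h'.elim this.1 this.2

end Orthogonal

theorem Orthogonal.map [Fintype E] {F' : Type*} [Hyperfield F'] {τ : HyperfieldInvolution F}
    {τ' : HyperfieldInvolution F'} (f : HyperfieldHom F F')
    (hf : ∀ x, f.toFun (τ.toFun x) = τ'.toFun (f.toFun x)) {X Y : E → F} (h : Orthogonal τ X Y) :
    Orthogonal τ' (fun e => f.toFun (X e)) (fun e => f.toFun (Y e)) := by
  have h' := f.map_mem_hypersum h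
  rw [f.toFun_zero] at h'
  unfold Orthogonal
  convert h' using 2
  funext e
  rw [f.toFun_mul, hf]

end HyperfieldMatroid

namespace HyperfieldMatroid

/-! ### From circuit elimination to a matroid -/

section Combinatorics

variable {E : Type*} [Finite E] {S : Set (Set E)}

/-- Augmentation by induction on `|I \ J|`. For `e ∈ I \ J`, either some exchange `J - f + e` stays
independent and is closer to `I`, or every `f ∈ J \ I` is avoided by a circuit in `J - f + e`
through `e`; eliminating `e` from two different such circuits leaves a circuit inside `J`. -/
theorem augment_of_elimination
    (helim : ∀ A ∈ S, ∀ B ∈ S, A ≠ B → ∀ e ∈ A ∩ B, ∃ C ∈ S, C ⊆ (A ∪ B) \ {e})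
    {I : Set E} (hI : ∀ A ∈ S, ¬ A ⊆ I) :
    ∀ (n : ℕ) (J : Set E), (I \ J).ncard = n → (∀ A ∈ S, ¬ A ⊆ J) → I.ncard < J.ncard →
      ∃ e ∈ J, e ∉ I ∧ ∀ A ∈ S, ¬ A ⊆ insert e I := by
  intro n
  induction n with
  | zero =>
    intro J hn hJ hlt
    have hIJ : I ⊆ J := by
      rwa [ncard_eq_zero, sdiff_eq_empty] at hn
    obtain ⟨e, heJ, heI⟩ := exists_mem_notMem_of_ncard_lt_ncard hlt
    exact ⟨e, heJ, heI, fun A hA h => hJ A hA (h.trans (insert_subset heJ hIJ))⟩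
  | succ n ih =>
    intro J hn hJ hlt
    obtain ⟨e, heI, heJ⟩ : (I \ J).Nonempty := by
      rw [← ncard_pos, hn]
      exact n.succ_pos
    by_cases hT : ∃ f ∈ J \ I, ∀ A ∈ S, ¬ A ⊆ insert e (J \ {f})
    · obtain ⟨f, ⟨hfJ, hfI⟩, hT⟩ := hT
      have h1 : I \ insert e (J \ {f}) = (I \ J) \ {e} := by
        ext x
        simp only [mem_sdiff, mem_insert_iff, mem_singleton_iff]
        grind
      obtain ⟨x, hx, hxI, hxA⟩ := ih (insert e (J \ {f}))
        (by rw [h1, ncard_sdiff_singleton_of_mem (show e ∈ I \ J from ⟨heI, heJ⟩), hn]; rfl) hT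
        (by rwa [ncard_exchange heJ hfJ])
      refine ⟨x, ?_, hxI, hxA⟩
      rcases hx with rfl | hx
      · exact absurd heI hxI
      · exact hx.1
    · push Not at hT
      choose! C hCS hC using hT
      have heC : ∀ f ∈ J \ I, e ∈ C f := by
        intro f hf
        by_contra he
        refine hJ _ (hCS f hf) fun x hx => ?_
        rcases hC f hf hx with rfl | h
        · exact absurd hx he
        · exact h.1
      have hne : ∀ f ∈ J \ I, f ∉ C f := by
        intro f hf hfC
        rcases hC f hf hfC with rfl | h
        · exact hf.2 heI
        · exact h.2 rfl
      obtain ⟨g, hgJ, hgI⟩ := exists_mem_notMem_of_ncard_lt_ncard hlt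
      -- Since `h ∈ C g` but `h ∉ C h`, the circuits `C g` and `C h` differ.
      obtain ⟨h, hhC, hhI⟩ := not_subset.1 (hI _ (hCS g ⟨hgJ, hgI⟩))
      have hhJ : h ∈ J := by
        rcases hC g ⟨hgJ, hgI⟩ hhC with rfl | h'
        · exact absurd heI hhI
        · exact h'.1
      obtain ⟨D, hDS, hD⟩ := helim _ (hCS g ⟨hgJ, hgI⟩) _ (hCS h ⟨hhJ, hhI⟩)
        (fun heq => hne h ⟨hhJ, hhI⟩ (heq ▸ hhC)) e ⟨heC g ⟨hgJ, hgI⟩, heC h ⟨hhJ, hhI⟩⟩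
      refine absurd ?_ (hJ D hDS)
      intro x hx
      obtain ⟨hx1 | hx1, hxe⟩ := hD hx
      · rcases hC g ⟨hgJ, hgI⟩ hx1 with h' | h'
        · exact absurd h' hxe
        · exact h'.1
      · rcases hC h ⟨hhJ, hhI⟩ hx1 with h' | h'
        · exact absurd h' hxe
        · exact h'.1

/-- A collection of sets that satisfies the circuit axioms is the collection of circuits of a
matroid. -/
theorem exists_matroid_isCircuit_iff (h0 : ∅ ∉ S) (hinc : ∀ A ∈ S, ∀ B ∈ S, A ⊆ B → A = B)
    (helim : ∀ A ∈ S, ∀ B ∈ S, A ≠ B → ∀ e ∈ A ∩ B, ∃ C ∈ S, C ⊆ (A ∪ B) \ {e}) :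
    ∃ U : Matroid E, U.E = univ ∧ ∀ A, U.IsCircuit A ↔ A ∈ S := by
  refine ⟨(IndepMatroid.ofFinite (E := univ) finite_univ (fun I => ∀ A ∈ S, ¬ A ⊆ I)
    (fun A hA h => h0 (subset_empty_iff.1 h ▸ hA)) (fun I J hJ hIJ A hA h => hJ A hA (h.trans hIJ))
    (fun I J hI hJ hlt => augment_of_elimination helim hI _ J rfl hJ hlt)
    (fun _ _ => subset_univ _)).matroid, rfl, fun A => ?_⟩
  rw [Matroid.isCircuit_iff_minimal_not_indep (subset_univ A)]
  simp only [IndepMatroid.matroid_Indep, IndepMatroid.ofFinite_indep, not_forall, not_not]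
  constructor
  · rintro ⟨⟨B, hB, hBA⟩, hmin⟩
    rwa [hBA.antisymm (hmin ⟨B, hB, subset_rfl⟩ hBA)] at hB
  · intro hA
    refine ⟨⟨A, hA, subset_rfl⟩, ?_⟩
    rintro B ⟨D, hD, hDB⟩ hBA
    exact (hinc D hD A hA (hDB.trans hBA)) ▸ hDB

/-- Elimination for modular pairs implies elimination for all pairs. -/
theorem elimination_of_modularPair
    (hmod : ∀ A B, IsModularPair S A B → ∀ e ∈ A ∩ B, ∃ C ∈ S, C ⊆ (A ∪ B) \ {e}) :
    ∀ (n : ℕ), ∀ A ∈ S, ∀ B ∈ S, (A ∪ B).ncard = n → A ≠ B → ∀ e ∈ A ∩ B,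
      ∃ C ∈ S, C ⊆ (A ∪ B) \ {e} := by
  intro n
  induction n using Nat.strong_induction_on with
  | _ n ih =>
    intro A hA B hB hn hne e he
    by_cases h : IsModularPair S A B
    · exact hmod A B h e he
    · obtain ⟨A', hA', B', hB', hne', hss⟩ :
          ∃ A' ∈ S, ∃ B' ∈ S, A' ≠ B' ∧ A' ∪ B' ⊂ A ∪ B := by
        by_contra hcon
        exact h ⟨hA, hB, hne, hcon⟩
      -- Either one of the two smaller sets already avoids `e`, or both contain it and the induction
      -- hypothesis applies to their union.
      by_cases heA : e ∈ A'
      · by_cases heB : e ∈ B'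
        · obtain ⟨C, hC, hCs⟩ := ih _ (hn ▸ ncard_lt_ncard hss) A' hA' B' hB' rfl hne' e ⟨heA, heB⟩
          exact ⟨C, hC, hCs.trans (sdiff_subset_sdiff_left hss.1)⟩
        · exact ⟨B', hB', fun x hx => ⟨hss.1 (Or.inr hx), fun hxe => heB (hxe ▸ hx)⟩⟩
      · exact ⟨A', hA', fun x hx => ⟨hss.1 (Or.inl hx), fun hxe => heA (hxe ▸ hx)⟩⟩

end Combinatorics

/-! ### Nullity as a measure of modularity -/

section Nullity

variable {E : Type*} {U : Matroid E} {A B C I T : Set E}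

/-- The nullity of a set in a matroid. -/
noncomputable def nullity (U : Matroid E) (A : Set E) : ℕ := A.ncard - (U.eRk A).toNat

variable [Finite E]

theorem nullity_eq_ncard_diff (h : U.IsBasis T A) : nullity U A = (A \ T).ncard := by
  rw [nullity, ← h.encard_eq_eRk, ncard_sdiff h.subset]
  rfl

theorem nullity_mono (hE : U.E = univ) (hAB : A ⊆ B) : nullity U A ≤ nullity U B := by
  obtain ⟨T, hT⟩ := U.exists_isBasis A (hE ▸ subset_univ _)
  obtain ⟨T', hT', h⟩ := hT.exists_isBasis_inter_eq_of_superset hAB (hE ▸ subset_univ _)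
  rw [nullity_eq_ncard_diff hT, nullity_eq_ncard_diff hT']
  refine ncard_le_ncard fun x hx => ⟨hAB hx.1, fun hxT => hx.2 ?_⟩
  rw [← h]
  exact ⟨hxT, hx.1⟩

/-- An element `x ∈ C \ A` is spanned by the rest of `C`, so deleting it from `B` lowers the size
but not the rank. -/
theorem nullity_lt (hE : U.E = univ) (hAB : A ⊆ B) (hC : U.IsCircuit C) (hCB : C ⊆ B)
    (hCA : ¬ C ⊆ A) : nullity U A < nullity U B := by
  obtain ⟨x, hxC, hxA⟩ := not_subset.1 hCA
  have hAx : A ⊆ B \ {x} := fun y hy => ⟨hAB hy, fun h => hxA (h ▸ hy)⟩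
  obtain ⟨T, hT⟩ := U.exists_isBasis (B \ {x}) (hE ▸ subset_univ _)
  have hxT : x ∉ T := fun h => (hT.subset h).2 rfl
  have hTB : U.IsBasis T B := by
    refine Matroid.isBasis_iff_indep_subset_closure.2 ⟨hT.indep, hT.subset.trans sdiff_subset, ?_⟩
    rw [hT.closure_eq_closure]
    intro y hy
    by_cases hyx : y = x
    · rw [hyx]
      exact U.closure_subset_closure (sdiff_subset_sdiff_left hCB)
        (hC.mem_closure_sdiff_singleton_of_mem hxC)
    · exact U.mem_closure_of_mem ⟨hy, hyx⟩ (hE ▸ subset_univ _)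
  refine (nullity_mono hE hAx).trans_lt ?_
  rw [nullity_eq_ncard_diff hT, nullity_eq_ncard_diff hTB]
  refine ncard_lt_ncard ⟨fun y hy => ⟨hy.1.1, hy.2⟩, fun h => ?_⟩
  exact (h ⟨hCB hxC, hxT⟩).1.2 rfl

theorem two_le_nullity_union (hE : U.E = univ) (hA : U.IsCircuit A) (hB : U.IsCircuit B)
    (hne : A ≠ B) : 2 ≤ nullity U (A ∪ B) := by
  have h1 : nullity U ∅ < nullity U A :=
    nullity_lt hE (empty_subset _) hA subset_rfl fun h =>
      hA.nonempty.ne_empty (subset_empty_iff.1 h)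
  have h2 : nullity U A < nullity U (A ∪ B) :=
    nullity_lt hE subset_union_left hB subset_union_right fun h =>
      hne (hB.eq_of_subset_isCircuit hA h).symm
  lia

theorem nullity_le_ncard_diff (hE : U.E = univ) (hI : U.Indep I) (h : I ⊆ A) :
    nullity U A ≤ (A \ I).ncard := by
  obtain ⟨T, hT, hIT⟩ := hI.subset_isBasis_of_subset h (hE ▸ subset_univ _)
  rw [nullity_eq_ncard_diff hT]
  exact ncard_le_ncard (sdiff_subset_sdiff_right hIT)

/-- A subset that spans and misses as many elements as the nullity is independent. -/
theorem indep_of_nullity_le (hE : U.E = univ) (hTA : T ⊆ A) (hsp : A ⊆ U.closure T)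
    (h : nullity U A ≤ (A \ T).ncard) : U.Indep T := by
  obtain ⟨T', hT'⟩ := U.exists_isBasis T (hE ▸ subset_univ _)
  have hT'A : U.IsBasis T' A := by
    refine Matroid.isBasis_iff_indep_subset_closure.2 ⟨hT'.indep, hT'.subset.trans hTA, ?_⟩
    rwa [hT'.closure_eq_closure]
  rw [nullity_eq_ncard_diff hT'A] at h
  have h1 : A \ T = A \ T' := eq_of_subset_of_ncard_le (sdiff_subset_sdiff_right hT'.subset) h
  have h2 : T = T' := by
    rw [← sdiff_sdiff_cancel_left hTA, h1, sdiff_sdiff_cancel_left hT'A.subset]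
  rw [h2]
  exact hT'.indep

/-- Each circuit has a private element, so adding the circuits one at a time raises the nullity each
time. -/
theorem le_nullity_iUnion (hE : U.E = univ) {n : ℕ} (X : Fin n → Set E)
    (hX : ∀ i, U.IsCircuit (X i)) (e : Fin n → E) (he : ∀ i, e i ∈ X i)
    (he' : ∀ i j, j ≠ i → e i ∉ X j) : n ≤ nullity U (⋃ i, X i) := by
  induction n with
  | zero => exact Nat.zero_le _
  | succ n ih =>
    have h1 := ih (fun i => X i.castSucc) (fun i => hX _) (fun i => e i.castSucc) (fun i => he _)
      (fun i j hij => he' _ _ fun h => hij (Fin.castSucc_injective _ h))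
    refine h1.trans_lt (nullity_lt hE (iUnion_subset fun i => subset_iUnion X _) (hX (Fin.last n))
      (subset_iUnion X _) fun h => ?_)
    obtain ⟨i, hi⟩ := mem_iUnion.1 (h (he (Fin.last n)))
    exact he' _ _ (Fin.castSucc_lt_last i).ne hi

/-- The union of fundamental circuits with respect to `T` has nullity equal to their number. -/
theorem nullity_iUnion_fundCircuit (hT : U.Indep T) {D : Set E} (hDT : Disjoint D T)
    (hD : D ⊆ U.closure T) : nullity U (⋃ b ∈ D, U.fundCircuit b T) = D.ncard := by
  set A := ⋃ b ∈ D, U.fundCircuit b T with hA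
  have hsub : A ⊆ D ∪ T := by
    refine iUnion₂_subset fun b hb => (U.fundCircuit_subset_insert b T).trans ?_
    exact insert_subset (Or.inl hb) subset_union_right
  have hDA : D ⊆ A := fun b hb => mem_iUnion₂.2 ⟨b, hb, U.mem_fundCircuit b T⟩
  have hdiff : A \ T = D := by
    ext x
    refine ⟨fun hx => (hsub hx.1).resolve_right hx.2, fun hx => ⟨hDA hx, fun h => ?_⟩⟩
    exact disjoint_left.1 hDT hx h
  have hbas : U.IsBasis (A ∩ T) A := by
    refine Matroid.isBasis_iff_indep_subset_closure.2
      ⟨hT.subset inter_subset_right, inter_subset_left, fun x hx => ?_⟩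
    by_cases hxT : x ∈ T
    · exact U.mem_closure_of_mem' ⟨hx, hxT⟩ (hT.subset_ground hxT)
    have hxD : x ∈ D := (hsub hx).resolve_right hxT
    have hc := hT.fundCircuit_isCircuit (hD hxD) hxT
    refine U.closure_subset_closure ?_ (hc.mem_closure_sdiff_singleton_of_mem
      (U.mem_fundCircuit x T))
    refine fun y hy => ⟨mem_iUnion₂.2 ⟨x, hxD, hy.1⟩, ?_⟩
    exact (U.fundCircuit_subset_insert x T hy.1).resolve_left hy.2
  rw [nullity_eq_ncard_diff hbas, sdiff_self_inter, hdiff]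

variable {S : Set (Set E)}

/-- If the nullity is at least 3, the fundamental circuits of two elements outside a basis of `A ∪
B` miss a third such element, so their union is properly smaller. Conversely two distinct circuits
already have nullity 2, and a proper inclusion of unions of circuits is strict on nullity. -/
theorem isModularPair_iff (hE : U.E = univ) (hS : ∀ A, U.IsCircuit A ↔ A ∈ S) :
    IsModularPair S A B ↔ A ∈ S ∧ B ∈ S ∧ A ≠ B ∧ nullity U (A ∪ B) ≤ 2 := by
  unfold IsModularPair
  refine and_congr_right fun hA => and_congr_right fun hB => and_congr_right fun hne => ?_
  constructor
  · intro h
    by_contra! hlt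
    obtain ⟨T, hT⟩ := U.exists_isBasis (A ∪ B) (hE ▸ subset_univ _)
    rw [nullity_eq_ncard_diff hT, two_lt_ncard] at hlt
    obtain ⟨a, ha, b, hb, c, hc, hab, hac, hbc⟩ := hlt
    have hcl := hT.subset_closure
    have hsub : ∀ x ∈ (A ∪ B) \ T, U.fundCircuit x T ⊆ A ∪ B := fun x hx =>
      (U.fundCircuit_subset_insert x T).trans (insert_subset hx.1 hT.subset)
    have hcirc : ∀ x ∈ (A ∪ B) \ T, U.fundCircuit x T ∈ S := fun x hx =>
      (hS _).1 (hT.indep.fundCircuit_isCircuit (hcl hx.1) hx.2)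
    have hnm : ∀ x ∈ (A ∪ B) \ T, ∀ y ∈ (A ∪ B) \ T, x ≠ y → x ∉ U.fundCircuit y T :=
      fun x hx y hy hxy h => by
        rcases U.fundCircuit_subset_insert y T h with h' | h'
        · exact hxy h'
        · exact hx.2 h'
    refine h ⟨_, hcirc a ha, _, hcirc b hb, fun h' => hnm a ha b hb hab ?_, ?_⟩
    · exact h' ▸ U.mem_fundCircuit a T
    · refine ⟨union_subset (hsub a ha) (hsub b hb), fun h' => ?_⟩
      rcases h' hc.1 with h'' | h''
      · exact hnm c hc a ha hac.symm h''
      · exact hnm c hc b hb hbc.symm h''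
  · rintro h ⟨A', hA', B', hB', hne', hss⟩
    have h2 := two_le_nullity_union hE ((hS _).2 hA') ((hS _).2 hB') hne'
    have h3 : nullity U (A' ∪ B') < nullity U (A ∪ B) := by
      by_cases hAs : A ⊆ A' ∪ B'
      · refine nullity_lt hE hss.1 ((hS _).2 hB) subset_union_right fun hBs => ?_
        exact hss.2 (union_subset hAs hBs)
      · exact nullity_lt hE hss.1 ((hS _).2 hA) subset_union_left hAs
    lia

/-- Nullity is strictly monotone on unions of circuits, which bounds the height above. A chain of
the right length arises by discarding the fundamental circuits of a basis one by one. -/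
theorem height_eq_nullity (hE : U.E = univ) (hS : ∀ A, U.IsCircuit A ↔ A ∈ S)
    (x : unionLattice S) : Order.height x = (nullity U x.1 : ℕ∞) := by
  apply le_antisymm
  · have hmono : StrictMono fun x : unionLattice S => nullity U x.1 := by
      rintro ⟨A, hA⟩ ⟨B, R, hR, rfl⟩ hAB
      obtain ⟨C, hCR, hCA⟩ : ∃ C ∈ R, ¬ C ⊆ A := by
        by_contra! h
        exact hAB.2 (sUnion_subset h)
      exact nullity_lt hE hAB.1 ((hS _).2 (hR hCR)) (subset_sUnion_of_mem hCR) hCA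
    have := Order.height_le_height_apply_of_strictMono _ hmono x
    rwa [Order.height_nat] at this
  · suffices h : ∀ (n : ℕ) (x : unionLattice S), n ≤ nullity U x.1 → (n : ℕ∞) ≤ Order.height x from
      h _ x le_rfl
    intro n
    induction n with
    | zero => simp
    | succ n ih =>
      rintro ⟨A, hA⟩ hn
      obtain ⟨T, hT⟩ := U.exists_isBasis A (hE ▸ subset_univ _)
      have hcard := nullity_eq_ncard_diff hT
      obtain ⟨a, ha⟩ : (A \ T).Nonempty := by
        rw [← ncard_pos]
        simp only at hn
        lia
      have hD : (A \ T) \ {a} ⊆ U.closure T := fun y hy => hT.subset_closure hy.1.1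
      have hnull := nullity_iUnion_fundCircuit hT.indep
        (disjoint_left.2 fun y (hy : y ∈ (A \ T) \ {a}) => hy.1.2) hD
      rw [ncard_sdiff_singleton_of_mem ha] at hnull
      let A' : unionLattice S := ⟨⋃ b ∈ (A \ T) \ {a}, U.fundCircuit b T,
        (fun b => U.fundCircuit b T) '' ((A \ T) \ {a}), by
          rintro _ ⟨b, hb, rfl⟩
          exact (hS _).1 (hT.indep.fundCircuit_isCircuit (hD hb) hb.1.2), by simp [sUnion_image]⟩
      have hlt : A' < ⟨A, hA⟩ := by
        refine ⟨iUnion₂_subset fun b hb => (U.fundCircuit_subset_insert b T).trans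
          (insert_subset hb.1.1 hT.subset), fun h => ?_⟩
        obtain ⟨b, hb, hab⟩ := mem_iUnion₂.1 (h ha.1)
        rcases U.fundCircuit_subset_insert b T hab with h' | h'
        · exact hb.2 h'.symm
        · exact ha.2 h'
      have h1 := ih A' (by simp only [A'] at hn ⊢; lia)
      push_cast
      exact (by gcongr : (n : ℕ∞) + 1 ≤ Order.height A' + 1).trans (Order.height_add_one_le hlt)

theorem isModularFamily_iff (hE : U.E = univ) (hS : ∀ A, U.IsCircuit A ↔ A ∈ S) {n : ℕ}
    (X : Fin n → Set E) :
    IsModularFamily S X ↔ (∀ i, X i ∈ S) ∧ nullity U (⋃ i, X i) = n := by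
  unfold IsModularFamily
  simp only [height_eq_nullity hE hS, Nat.cast_inj]
  exact ⟨fun ⟨h, h'⟩ => ⟨h, h'⟩, fun ⟨h, h'⟩ => ⟨h, h'⟩⟩

end Nullity

/-! ### Circuits meeting a cocircuit in two elements -/

section Cocircuits

variable {E : Type*} {U : Matroid E} {C K I X : Set E} {e f : E}

/-- A basis of the complement of a cocircuit, extended by an element of the cocircuit, is a base. -/
theorem isBase_insert_of_isBasis_compl (hE : U.E = univ) (hK : U.IsCocircuit K)
    (hI : U.IsBasis I Kᶜ) (he : e ∈ K) : U.IsBase (insert e I) := by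
  have hK' := Matroid.isCocircuit_iff_minimal_compl_nonspanning.1 hK
  have hsub : ∀ A, A ⊆ U.E := fun A => hE ▸ subset_univ A
  have hns : ¬ U.Spanning Kᶜ := by
    have := hK'.prop
    rwa [hE, ← compl_eq_univ_sdiff] at this
  -- By minimality of the cocircuit, removing `e` from `K` makes the complement spanning.
  have hsp : U.Spanning (insert e Kᶜ) := by
    have := hK'.not_prop_of_ssubset (sdiff_singleton_ssubset.2 he)
    rw [not_not, hE] at this
    convert this using 1
    ext x
    simp only [mem_insert_iff, mem_compl_iff, mem_sdiff, mem_univ, mem_singleton_iff]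
    tauto
  have hcl : e ∉ U.closure I := by
    intro h
    apply hns
    rw [hI.closure_eq_closure] at h
    rw [Matroid.spanning_iff_closure_eq (hsub _), ← Matroid.closure_insert_eq_of_mem_closure h]
    exact hsp.closure_eq
  have hind : U.Indep (insert e I) :=
    Matroid.insert_indep_iff.2 ⟨hI.indep, fun _ => ⟨hsub {e} rfl, hcl⟩⟩
  refine hind.isBase_of_ground_subset_closure ?_
  rw [Matroid.closure_insert_congr_right hI.closure_eq_closure, hsp.closure_eq]

/-- The fundamental circuit of an element of a cocircuit. -/
theorem exists_isCircuit_subset_insert_insert (hE : U.E = univ) (hK : U.IsCocircuit K)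
    (hI : U.IsBasis I Kᶜ) (he : e ∈ K) (hf : f ∈ K) (hef : e ≠ f) :
    ∃ C, U.IsCircuit C ∧ C ⊆ insert f (insert e I) ∧ C ∩ K = {e, f} := by
  have hB := isBase_insert_of_isBasis_compl hE hK hI he
  have hfB : f ∉ insert e I := by
    rintro (h | h)
    · exact hef h.symm
    · exact hI.subset h hf
  have hC := hB.fundCircuit_isCircuit (hE ▸ mem_univ f) hfB
  have hsub := U.fundCircuit_subset_insert f (insert e I)
  have hfC := U.mem_fundCircuit f (insert e I)
  have hsub' : U.fundCircuit f (insert e I) ∩ K ⊆ {e, f} := by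
    rintro x ⟨hx, hxK⟩
    rcases hsub hx with h | h | h
    · exact Or.inr h
    · exact Or.inl h
    · exact absurd hxK (hI.subset h)
  refine ⟨_, hC, hsub, hsub'.antisymm (pair_subset_iff.2 ⟨?_, hfC, hf⟩)⟩
  -- Without `e` the circuit would meet the cocircuit in `f` alone.
  by_contra he'
  refine hC.inter_isCocircuit_ne_singleton hK (e := f) (subset_antisymm (fun x hx => ?_) ?_)
  · rcases hsub' hx with h' | h'
    · exact absurd (h' ▸ hx) he'
    · exact h'
  · exact singleton_subset_iff.2 ⟨hfC, hf⟩

/-- A circuit meeting the cocircuit `K` lies in a basis of `Kᶜ` up to its elements in `K`. -/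
theorem exists_isBasis_compl_of_isCircuit (hE : U.E = univ) (hC : U.IsCircuit C) (he : e ∈ C)
    (heK : e ∈ K) : ∃ I, U.IsBasis I Kᶜ ∧ C \ K ⊆ I := by
  have hI : U.Indep (C \ K) := (hC.sdiff_singleton_indep he).subset fun x hx =>
    ⟨hx.1, fun h => hx.2 (h ▸ heK)⟩
  exact hI.subset_isBasis_of_subset (fun x hx => hx.2) (hE ▸ subset_univ _)

end Cocircuits

end HyperfieldMatroid

namespace HyperfieldMatroid

open Hyperfield HyperSet

theorem hypersum_fin_two {F : Type*} [Hyperfield F] (g : Fin 2 → F) :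
    hypersum g = hadd (g 0) (g 1) := by
  rw [hypersum_eq_sum, Fin.sum_univ_two, toSet_add_single]

/-! ### Signatures and elimination axioms -/

section Signature

variable {F E : Type*} [Hyperfield F] {U : Matroid E} {C : Set (E → F)}

/-- `C` is an `F`-signature of the matroid `U`. -/
structure IsSignature (U : Matroid E) (C : Set (E → F)) : Prop extends IsPreCircuitSet C where
  ground_eq : U.E = univ
  isCircuit_iff : ∀ A, U.IsCircuit A ↔ A ∈ supports C

theorem IsSignature.isUnderlyingMatroid (h : IsSignature U C) : IsUnderlyingMatroid U C :=
  ⟨h.ground_eq, h.isCircuit_iff⟩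

theorem IsSignature.isCircuit (h : IsSignature U C) {X : E → F} (hX : X ∈ C) :
    U.IsCircuit (support X) :=
  (h.isCircuit_iff _).2 ⟨X, hX, rfl⟩

theorem IsSignature.exists_of_isCircuit (h : IsSignature U C) {A : Set E} (hA : U.IsCircuit A) :
    ∃ X ∈ C, support X = A :=
  (h.isCircuit_iff A).1 hA

theorem IsUnderlyingMatroid.unique {U' : Matroid E} (h : IsUnderlyingMatroid U C)
    (h' : IsUnderlyingMatroid U' C) : U = U' :=
  Matroid.ext_isCircuit (h.1.trans h'.1.symm) fun A _ => (h.2 A).trans (h'.2 A).symm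

theorem IsPreCircuitSet.exists_rescale (h : IsPreCircuitSet C) {Y : E → F} (hY : Y ∈ C) {e : E}
    (he : Y e ≠ 0) {c : F} (hc : c ≠ 0) :
    ∃ Y' ∈ C, support Y' = support Y ∧ Y' e = c ∧ ∀ g, Y' g = c / Y e * Y g :=
  ⟨fun g => c / Y e * Y g, h.smul_mem Y hY _ (div_ne_zero hc he),
    support_const_mul (div_ne_zero hc he) Y, div_mul_cancel₀ c he, fun _ => rfl⟩

/-- Strong modular elimination of `k` elements, with modularity expressed through nullity. -/
def HasElimination (U : Matroid E) (C : Set (E → F)) (k : ℕ) : Prop :=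
  ∀ X : Fin (k + 1) → E → F, (∀ i, X i ∈ C) → nullity U (⋃ i, support (X i)) ≤ k + 1 →
    ¬ support (X 0) ⊆ ⋃ i : Fin k, support (X i.succ) →
    ∀ e : Fin k → E, (∀ i, X 0 (e i) = -X i.succ (e i) ∧ X 0 (e i) ≠ 0) →
      (∀ i j, j ≠ i → e i ∉ support (X j.succ)) →
      ∃ Z ∈ C, (∀ i, Z (e i) = 0) ∧ ∀ g, Z g ∈ hypersum (fun i => X i g)

/-- Modular elimination for pairs, with modularity expressed through nullity. -/
def HasPairElimination (U : Matroid E) (C : Set (E → F)) : Prop :=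
  ∀ X ∈ C, ∀ Y ∈ C, support X ≠ support Y → nullity U (support X ∪ support Y) ≤ 2 →
    ∀ e, X e = -Y e → X e ≠ 0 → ∃ Z ∈ C, Z e = 0 ∧ ∀ g, Z g ∈ hadd (X g) (Y g)

/-- Proved from the lattice alone, because it is needed before an underlying matroid is available. A
chain of length two below a proper subunion would give two distinct members with too small a union;
the chain `∅ ⊂ A 0 ⊂ A 0 ∪ A 1` gives the other bound. -/
theorem isModularFamily_pair {S : Set (Set E)} (h0 : ∅ ∉ S)
    (hinc : ∀ A ∈ S, ∀ B ∈ S, A ⊆ B → A = B) {A : Fin 2 → Set E}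
    (h : IsModularPair S (A 0) (A 1)) : IsModularFamily S A := by
  obtain ⟨hA, hB, hne, hmod⟩ := h
  have hmem : ∀ i, A i ∈ S := Fin.forall_fin_two.2 ⟨hA, hB⟩
  have hU : ⋃ i, A i = A 0 ∪ A 1 := by
    ext x
    simp [Fin.exists_fin_two]
  refine ⟨hmem, le_antisymm ?_ ?_⟩
  · refine Order.height_le_coe_iff.2 fun y hy => ?_
    by_contra! hlt
    obtain ⟨b, c, hcb, hby⟩ := Order.one_lt_height_iff.1
      (lt_of_lt_of_le (by norm_num : (1 : ℕ∞) < ((2 : ℕ) : ℕ∞)) hlt)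
    have key : ∀ u v : unionLattice S, u < v → ∃ P ∈ S, P ⊆ v.1 ∧ ¬ P ⊆ u.1 := by
      rintro u ⟨_, T, hT, rfl⟩ huv
      by_contra! hcon
      exact huv.2 (sUnion_subset fun P hP => hcon P (hT hP) (subset_sUnion_of_mem hP))
    obtain ⟨P, hP, hPb, -⟩ := key c b hcb
    obtain ⟨Q, hQ, hQy, hQb⟩ := key b y hby
    refine hmod ⟨P, hP, Q, hQ, fun h => hQb (h ▸ hPb), ?_⟩
    have hyU : y.1 ⊂ A 0 ∪ A 1 := hU ▸ hy
    exact (union_subset (hPb.trans hby.1) hQy).trans_ssubset hyU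
  · have h1 : (1 : ℕ∞) <
        Order.height (⟨⋃ i, A i, iUnion_mem_unionLattice hmem⟩ : unionLattice S) := by
      refine Order.one_lt_height_iff.2 ⟨⟨A 0, {A 0}, by simpa using hA, by simp⟩,
        ⟨∅, ∅, empty_subset _, by simp⟩, ⟨empty_subset _, fun h => ?_⟩,
        ⟨subset_iUnion A 0, fun h => ?_⟩⟩
      · exact h0 (subset_empty_iff.1 h ▸ hA)
      · exact hne (hinc _ hB _ hA ((subset_iUnion A 1).trans h)).symm
    exact Order.add_one_le_of_lt h1

theorem IsPreCircuitSet.empty_notMem_supports (h : IsPreCircuitSet C) : ∅ ∉ supports C := by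
  rintro ⟨X, hX, hX0⟩
  rw [support_eq_empty_iff] at hX0
  rw [hX0] at hX
  exact h.zero_notMem hX

theorem IsPreCircuitSet.supports_eq_of_subset (h : IsPreCircuitSet C) :
    ∀ A ∈ supports C, ∀ B ∈ supports C, A ⊆ B → A = B := by
  rintro _ ⟨X, hX, rfl⟩ _ ⟨Y, hY, rfl⟩ hAB
  obtain ⟨a, ha, rfl⟩ := h.incomparable X hX Y hY hAB
  exact support_const_mul ha Y

theorem IsStrongCircuitSet.isWeakCircuitSet (h : IsStrongCircuitSet C) : IsWeakCircuitSet C := by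
  refine { h.toIsPreCircuitSet with modular_elimination := fun X hX Y hY hmod e he he0 => ?_ }
  obtain ⟨Z, hZ, hZe, hZg⟩ := h.strong_modular_elimination 1 ![X, Y]
    (Fin.forall_fin_two.2 ⟨hX, hY⟩)
    (isModularFamily_pair h.empty_notMem_supports h.supports_eq_of_subset
      (by simpa using hmod))
    (fun hsub => hmod.2.2.1 (h.supports_eq_of_subset _ hmod.1 _ hmod.2.1 (by simpa using hsub)))
    (fun _ => e) (fun i => by simpa [Subsingleton.elim i 0] using ⟨he, he0⟩)
    (fun i j hij => absurd (Subsingleton.elim j i) hij)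
  refine ⟨Z, hZ, hZe 0, fun g => ?_⟩
  have := hZg g
  rwa [hypersum_fin_two] at this

theorem mem_union_of_mem_hadd {x y z : F} (hz : z ∈ hadd x y) (h0 : z ≠ 0) : x ≠ 0 ∨ y ≠ 0 := by
  by_contra! h
  rw [h.1, h.2, zero_hadd] at hz
  exact h0 hz

/-- Rescaling `Y` makes the two values at `e` cancel, so supports satisfy elimination for modular
pairs, hence for all pairs. -/
theorem IsWeakCircuitSet.exists_isSignature [Finite E] (h : IsWeakCircuitSet C) :
    ∃ U : Matroid E, IsSignature U C := by
  have hmod : ∀ A B, IsModularPair (supports C) A B → ∀ e ∈ A ∩ B,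
      ∃ D ∈ supports C, D ⊆ (A ∪ B) \ {e} := by
    rintro _ _ hAB e he
    obtain ⟨X, hX, rfl⟩ := hAB.1
    obtain ⟨Y, hY, rfl⟩ := hAB.2.1
    obtain ⟨Y', hY', hs, hY'e, -⟩ := h.exists_rescale hY he.2
      (show -X e ≠ 0 from neg_eq_zero_iff'.not.2 he.1)
    rw [← hs] at hAB ⊢
    obtain ⟨Z, hZ, hZe, hZg⟩ := h.modular_elimination X hX Y' hY' hAB e
      (by rw [hY'e, neg_neg]) he.1
    refine ⟨_, ⟨Z, hZ, rfl⟩, fun g hg => ⟨mem_union_of_mem_hadd (hZg g) hg, ?_⟩⟩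
    rintro rfl
    exact hg hZe
  obtain ⟨U, hU, hUC⟩ := exists_matroid_isCircuit_iff h.empty_notMem_supports
    h.supports_eq_of_subset fun A hA B hB hne e he =>
      elimination_of_modularPair hmod _ A hA B hB rfl hne e he
  exact ⟨U, { h.toIsPreCircuitSet with ground_eq := hU, isCircuit_iff := hUC }⟩

theorem HasPairElimination.hasElimination_one (h : HasPairElimination U C) :
    HasElimination U C 1 := by
  intro X hX hnull hns e he _
  have hU : ⋃ i, support (X i) = support (X 0) ∪ support (X 1) := by
    ext x
    simp only [mem_iUnion, mem_union]
    exact Fin.exists_fin_two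
  obtain ⟨Z, hZ, hZe, hZg⟩ := h (X 0) (hX 0) (X 1) (hX 1)
    (fun heq => hns (heq ▸ subset_iUnion (fun i : Fin 1 => support (X i.succ)) 0))
    (hU ▸ hnull) (e 0) (he 0).1 (he 0).2
  refine ⟨Z, hZ, fun i => by rwa [Subsingleton.elim i 0], fun g => ?_⟩
  rw [hypersum_fin_two]
  exact hZg g

variable [Finite E]

theorem IsWeakCircuitSet.hasPairElimination (h : IsWeakCircuitSet C) (hU : IsSignature U C) :
    HasPairElimination U C := fun X hX Y hY hne hnull =>
  h.modular_elimination X hX Y hY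
    ((isModularPair_iff hU.ground_eq hU.isCircuit_iff).2 ⟨⟨X, hX, rfl⟩, ⟨Y, hY, rfl⟩, hne, hnull⟩)

theorem HasElimination.isWeakCircuitSet (h : HasElimination U C 1) (hU : IsSignature U C) :
    IsWeakCircuitSet C := by
  refine { hU.toIsPreCircuitSet with modular_elimination := fun X hX Y hY hmod e he he0 => ?_ }
  have hnull := ((isModularPair_iff hU.ground_eq hU.isCircuit_iff).1 hmod).2.2.2
  have hUn : ⋃ i, support ((![X, Y] : Fin 2 → E → F) i) = support X ∪ support Y := by
    ext x
    simp [Fin.exists_fin_two]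
  obtain ⟨Z, hZ, hZe, hZg⟩ := h ![X, Y] (Fin.forall_fin_two.2 ⟨hX, hY⟩) (hUn ▸ hnull)
    (fun hsub => hmod.2.2.1 (hU.supports_eq_of_subset _ hmod.1 _ hmod.2.1 (by simpa using hsub)))
    (fun _ => e) (fun i => by simpa [Subsingleton.elim i 0] using ⟨he, he0⟩)
    (fun i j hij => absurd (Subsingleton.elim j i) hij)
  refine ⟨Z, hZ, hZe 0, fun g => ?_⟩
  have := hZg g
  rwa [hypersum_fin_two] at this

/-- The bound `≤ k + 1` is automatically an equality: the private elements `e i` give nullity at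
least `k` for the `X i.succ`, and `X 0` is not covered by them. -/
theorem IsStrongCircuitSet.hasElimination (h : IsStrongCircuitSet C) (hU : IsSignature U C)
    (k : ℕ) : HasElimination U C k := by
  intro X hX hnull hns e he he'
  refine h.strong_modular_elimination k X hX ?_ hns e he he'
  refine (isModularFamily_iff hU.ground_eq hU.isCircuit_iff _).2
    ⟨fun i => ⟨X i, hX i, rfl⟩, le_antisymm hnull ?_⟩
  refine (le_nullity_iUnion hU.ground_eq (fun i : Fin k => support (X i.succ))
    (fun i => hU.isCircuit (hX _)) e (fun i => ?_) he').trans_lt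
    (nullity_lt hU.ground_eq (iUnion_subset fun i => subset_iUnion (fun i => support (X i)) _)
      (hU.isCircuit (hX 0)) (subset_iUnion (fun i => support (X i)) 0) hns)
  intro h0
  have := (he i).1
  rw [h0, neg_zero_eq] at this
  exact (he i).2 this

theorem isStrongCircuitSet_of_hasElimination (hU : IsSignature U C)
    (h : ∀ k, HasElimination U C k) : IsStrongCircuitSet C := by
  refine { hU.toIsPreCircuitSet with
    strong_modular_elimination := fun k X hX hmod hns e he he' => h k X hX ?_ hns e he he' }
  exact ((isModularFamily_iff hU.ground_eq hU.isCircuit_iff _).1 hmod).2.le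

end Signature

/-! ### Ratios of circuits along a cocircuit -/

section DualSignature

variable {F E : Type*} [Hyperfield F] {U : Matroid E} {C : Set (E → F)}
  {K I J : Set E} {X Y Z : E → F} {e f : E}

theorem IsSignature.exists_inter_eq_pair (hU : IsSignature U C) (hK : U.IsCocircuit K)
    (hI : U.IsBasis I Kᶜ) (he : e ∈ K) (hf : f ∈ K) (hef : e ≠ f) :
    ∃ X ∈ C, support X ⊆ insert f (insert e I) ∧ support X ∩ K = {e, f} := by
  obtain ⟨A, hA, hsub, hAK⟩ := exists_isCircuit_subset_insert_insert hU.ground_eq hK hI he hf hef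
  obtain ⟨X, hX, rfl⟩ := hU.exists_of_isCircuit hA
  exact ⟨X, hX, hsub, hAK⟩

/-- Scale `Y` to cancel `X` at `e` and eliminate `e`. The result can meet `K` only in `f`, which is
impossible for a circuit and a cocircuit, so the values at `f` cancel too. -/
theorem mul_eq_mul_of_nullity_le_two (hU : IsSignature U C) (hC : HasPairElimination U C)
    (hK : U.IsCocircuit K) (hef : e ≠ f) (hX : X ∈ C) (hY : Y ∈ C)
    (hXK : support X ∩ K = {e, f}) (hYK : support Y ∩ K = {e, f})
    (hnull : nullity U (support X ∪ support Y) ≤ 2) : X f * Y e = Y f * X e := by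
  have hXe : X e ≠ 0 := (hXK.symm.subset (Or.inl rfl)).1
  have hYe : Y e ≠ 0 := (hYK.symm.subset (Or.inl rfl)).1
  by_cases hne : support X = support Y
  · obtain ⟨a, ha, rfl⟩ := hU.incomparable X hX Y hY hne.le
    ring_nf
    ac_rfl
  obtain ⟨Y', hY', hs, hY'e, hY'g⟩ := hU.exists_rescale hY hYe
    (show -X e ≠ 0 from neg_eq_zero_iff'.not.2 hXe)
  obtain ⟨Z, hZ, hZe, hZg⟩ := hC X hX Y' hY' (hs ▸ hne) (hs ▸ hnull) e (by rw [hY'e, neg_neg]) hXe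
  have hZf : Z f = 0 := by
    by_contra hZf
    refine (hU.isCircuit hZ).inter_isCocircuit_ne_singleton hK (e := f)
      (subset_antisymm ?_ (singleton_subset_iff.2 ⟨hZf, (hXK.symm.subset (Or.inr rfl)).2⟩))
    rintro x ⟨hx, hxK⟩
    have hx' : x ∈ ({e, f} : Set E) := by
      rcases mem_union_of_mem_hadd (hZg x) hx with h | h
      · exact hXK.subset ⟨h, hxK⟩
      · exact hYK.subset ⟨hs ▸ h, hxK⟩
    rcases hx' with rfl | h
    · exact absurd hZe hx
    · exact h
  have h := hZg f
  rw [hZf, zero_mem_hadd_iff, hY'g, neg_div, neg_mul, neg_inj] at h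
  rw [← h, div_mul_eq_mul_div, div_mul_cancel₀ _ hYe, mul_comm]

theorem support_subset_insert_insert (hXK : support X ∩ K = {e, f}) (hXI : support X \ K ⊆ I) :
    support X ⊆ insert f (insert e I) := by
  intro x hx
  by_cases hxK : x ∈ K
  · rcases hXK.subset ⟨hx, hxK⟩ with rfl | h
    · exact Or.inr (Or.inl rfl)
    · exact Or.inl h
  · exact Or.inr (Or.inr (hXI ⟨hx, hxK⟩))

variable [Finite E]

/-- Basis exchange inside `Kᶜ` moves `I` to `J` one element at a time. Circuits of neighbouring
bases lie in a base plus two elements, hence have nullity at most 2 and equal ratios. -/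
theorem mul_eq_mul_of_isBasis (hU : IsSignature U C) (hC : HasPairElimination U C)
    (hK : U.IsCocircuit K) (hef : e ≠ f) (he : e ∈ K) (hf : f ∈ K) (hJ : U.IsBasis J Kᶜ)
    (hY : Y ∈ C) (hYK : support Y ∩ K = {e, f}) (hYJ : support Y \ K ⊆ J) :
    ∀ (n : ℕ) (I : Set E), U.IsBasis I Kᶜ → (J \ I).ncard = n → ∀ X ∈ C,
      support X ∩ K = {e, f} → support X \ K ⊆ I → X f * Y e = Y f * X e := by
  intro n
  have hKE : Kᶜ ⊆ U.E := hU.ground_eq ▸ subset_univ _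
  induction n with
  | zero =>
    intro I hI hn X hX hXK hXI
    have hJI : J ⊆ I := by
      rwa [ncard_eq_zero, sdiff_eq_empty] at hn
    have hsub : insert e I ⊆ insert f (insert e I) := subset_insert _ _
    refine mul_eq_mul_of_nullity_le_two hU hC hK hef hX hY hXK hYK ?_
    refine (nullity_mono hU.ground_eq (union_subset (support_subset_insert_insert hXK hXI)
      (support_subset_insert_insert hYK (hYJ.trans hJI)))).trans ?_
    refine (nullity_le_ncard_diff hU.ground_eq
      (isBase_insert_of_isBasis_compl hU.ground_eq hK hI he).indep hsub).trans ?_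
    refine (ncard_le_ncard (t := {f}) fun x hx => hx.1.resolve_right hx.2).trans ?_
    rw [ncard_singleton]
    lia
  | succ n ih =>
    intro I hI hn X hX hXK hXI
    have hne : ¬ I ⊆ J := by
      intro h
      have := hI.eq_of_subset_indep hJ.indep h hJ.subset
      simp [this] at hn
    obtain ⟨a, haI, haJ⟩ := not_subset.1 hne
    obtain ⟨b, ⟨hbJ, hbI⟩, hb⟩ := (U.restrict Kᶜ).isBase_exchange I J
      ((Matroid.isBase_restrict_iff hKE).2 hI) ((Matroid.isBase_restrict_iff hKE).2 hJ) a ⟨haI, haJ⟩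
    rw [Matroid.isBase_restrict_iff hKE] at hb
    obtain ⟨X', hX', hX's, hX'K⟩ := hU.exists_inter_eq_pair hK hb he hf hef
    have hX'I : support X' \ K ⊆ insert b (I \ {a}) := by
      rintro x ⟨hx, hxK⟩
      rcases hX's hx with rfl | rfl | h
      · exact absurd hf hxK
      · exact absurd he hxK
      · exact h
    have h1 := ih _ hb (by
      have : J \ insert b (I \ {a}) = (J \ I) \ {b} := by
        ext x
        simp only [mem_sdiff, mem_insert_iff, mem_singleton_iff]
        grind
      rw [this, ncard_sdiff_singleton_of_mem (show b ∈ J \ I from ⟨hbJ, hbI⟩), hn]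
      rfl) X' hX' hX'K hX'I
    have h2 : X f * X' e = X' f * X e := by
      refine mul_eq_mul_of_nullity_le_two hU hC hK hef hX hX' hXK hX'K ?_
      have hsub : support X ∪ support X' ⊆ insert f (insert b (insert e I)) := by
        refine union_subset ((support_subset_insert_insert hXK hXI).trans ?_) (hX's.trans ?_)
        · exact insert_subset_insert (subset_insert _ _)
        · refine insert_subset_insert ?_
          rw [insert_comm]
          exact insert_subset_insert (insert_subset_insert sdiff_subset)
      refine (nullity_mono hU.ground_eq hsub).trans ((nullity_le_ncard_diff hU.ground_eq
        (isBase_insert_of_isBasis_compl hU.ground_eq hK hI he).indep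
        ((subset_insert _ _).trans (subset_insert _ _))).trans ?_)
      refine (ncard_le_ncard (t := {f, b}) ?_).trans
        ((ncard_insert_le f {b}).trans (by rw [ncard_singleton]))
      rintro x ⟨rfl | rfl | h, hx⟩
      · exact Or.inl rfl
      · exact Or.inr rfl
      · exact absurd h hx
    have hX'e : X' e ≠ 0 := (hX'K.symm.subset (Or.inl rfl)).1
    apply mul_right_cancel₀ hX'e
    calc X f * Y e * X' e = (X f * X' e) * Y e := by ac_rfl
      _ = (X' f * Y e) * X e := by rw [h2]; ac_rfl
      _ = Y f * X e * X' e := by rw [h1]; ac_rfl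

end DualSignature
end HyperfieldMatroid

namespace HyperfieldMatroid

open Hyperfield HyperSet

/-! ### The dual signature; orthogonality versus elimination -/

section DualPair

variable {F E : Type*} [Hyperfield F] {U : Matroid E} {C D : Set (E → F)}
  {K : Set E} {X Y : E → F} {e f : E}

theorem mul_eq_mul_of_inter_eq_pair [Finite E] (hU : IsSignature U C)
    (hC : HasPairElimination U C) (hK : U.IsCocircuit K) (hef : e ≠ f) (hX : X ∈ C) (hY : Y ∈ C)
    (hXK : support X ∩ K = {e, f}) (hYK : support Y ∩ K = {e, f}) : X f * Y e = Y f * X e := by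
  have he := hXK.symm.subset (Or.inl rfl)
  have hf := hXK.symm.subset (Or.inr rfl)
  obtain ⟨I, hI, hXI⟩ := exists_isBasis_compl_of_isCircuit hU.ground_eq (hU.isCircuit hX) he.1 he.2
  obtain ⟨J, hJ, hYJ⟩ := exists_isBasis_compl_of_isCircuit hU.ground_eq (hU.isCircuit hY)
    (hYK.symm.subset (Or.inl rfl)).1 he.2
  exact mul_eq_mul_of_isBasis hU hC hK hef he.2 hf.2 hJ hY hYK hYJ _ I hI rfl X hX hXK hXI

theorem exists_isBasis_compl (hU : IsSignature U C) (K : Set E) : ∃ I, U.IsBasis I Kᶜ :=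
  U.exists_isBasis _ (hU.ground_eq ▸ subset_univ _)

variable [Fintype E] {τ : HyperfieldInvolution F}

/-- Fix `c ∈ K` and let a reference circuit `W f` meeting `K` in `{c, f}` prescribe the value at
`f`. Pairs containing `c` are then right because ratios do not depend on the circuit. For a pair
`{a, b}` without `c`, eliminating `c` between `W a` and a multiple of `W b` produces a circuit
meeting `K` in `{a, b}` with known values. -/
theorem exists_orthogonal_of_isCocircuit (τ : HyperfieldInvolution F) (hU : IsSignature U C)
    (hC : HasPairElimination U C) (hK : U.IsCocircuit K) :
    ∃ Y : E → F, support Y = K ∧ ∀ X ∈ C, ∀ e f, e ≠ f → support X ∩ K = {e, f} →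
      X f * τ.toFun (Y f) = -(X e * τ.toFun (Y e)) := by
  classical
  obtain ⟨c, hc⟩ := hK.nonempty
  obtain ⟨I, hI⟩ := exists_isBasis_compl hU K
  have hW : ∀ f, ∃ W : E → F, f ∈ K → c ≠ f →
      W ∈ C ∧ support W ⊆ insert f (insert c I) ∧ support W ∩ K = {c, f} := by
    intro f
    by_cases h : f ∈ K ∧ c ≠ f
    · obtain ⟨W, hW⟩ := hU.exists_inter_eq_pair hK hI hc h.1 h.2
      exact ⟨W, fun _ _ => hW⟩
    · exact ⟨fun _ => 0, fun h1 h2 => absurd ⟨h1, h2⟩ h⟩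
  choose W hW using hW
  have hWc : ∀ f ∈ K, c ≠ f → W f c ≠ 0 := fun f hf hcf =>
    ((hW f hf hcf).2.2.symm.subset (Or.inl rfl)).1
  have hWf : ∀ f ∈ K, c ≠ f → W f f ≠ 0 := fun f hf hcf =>
    ((hW f hf hcf).2.2.symm.subset (Or.inr rfl)).1
  let y : E → F := fun f => if f ∈ K then if c = f then 1 else -(W f c / W f f) else 0
  have hyc : y c = 1 := by simp [y, hc]
  have hyf : ∀ f ∈ K, c ≠ f → y f = -(W f c / W f f) := fun f hf hcf => by simp [y, hf, hcf]
  have hone : ∀ X ∈ C, ∀ f ∈ K, c ≠ f → support X ∩ K = {c, f} → X f * y f = -(X c * y c) := by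
    intro X hX f hf hcf hXK
    have h := mul_eq_mul_of_inter_eq_pair hU hC hK hcf hX (hW f hf hcf).1 hXK (hW f hf hcf).2.2
    rw [hyc, hyf f hf hcf, mul_neg, neg_inj, mul_one, ← mul_div_assoc, h,
      mul_div_cancel_left₀ _ (hWf f hf hcf)]
  -- The inner product conjugates its second argument, so the witness is the conjugate of `y`.
  refine ⟨fun f => τ.toFun (y f), ?_, ?_⟩
  · ext f
    rw [mem_support, Ne, τ.toFun_eq_zero]
    by_cases hf : f ∈ K
    · by_cases hcf : c = f
      · subst hcf
        simp [hyc, hc]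
      · rw [hyf f hf hcf, neg_eq_zero_iff', div_eq_zero_iff]
        simp [hWc f hf hcf, hWf f hf hcf, hf]
    · simp [y, hf]
  · intro X hX a b hab hXK
    simp only [τ.invol]
    have ha := (hXK.symm.subset (Or.inl rfl)).2
    have hb := (hXK.symm.subset (Or.inr rfl)).2
    by_cases hca : c = a
    · subst hca
      exact hone X hX b hb hab hXK
    by_cases hcb : c = b
    · subst hcb
      rw [pair_comm] at hXK
      rw [hone X hX a ha hab.symm hXK, neg_neg]
    obtain ⟨hWa, hWas, hWaK⟩ := hW a ha hca
    obtain ⟨hWb, hWbs, hWbK⟩ := hW b hb hcb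
    obtain ⟨V, hV, hVs, hVc, hVg⟩ := hU.exists_rescale hWb (hWc b hb hcb)
      (show -W a c ≠ 0 from neg_eq_zero_iff'.not.2 (hWc a ha hca))
    have hab' : W a b = 0 := by
      by_contra h
      rcases hWaK.subset ⟨h, hb⟩ with h' | h'
      · exact hcb h'.symm
      · exact hab h'.symm
    have hba' : V a = 0 := by
      by_contra h
      rcases hWbK.subset ⟨hVs.subset h, ha⟩ with h' | h'
      · exact hca h'.symm
      · exact hab h'
    have hnull : nullity U (support (W a) ∪ support V) ≤ 2 := by
      have hsub : support (W a) ∪ support V ⊆ insert a (insert b (insert c I)) := by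
        rw [hVs]
        exact union_subset (hWas.trans (insert_subset_insert (subset_insert _ _)))
          (hWbs.trans (subset_insert _ _))
      refine (nullity_mono hU.ground_eq hsub).trans ((nullity_le_ncard_diff hU.ground_eq
        (isBase_insert_of_isBasis_compl hU.ground_eq hK hI hc).indep
        ((subset_insert _ _).trans (subset_insert _ _))).trans ?_)
      refine (ncard_le_ncard (t := {a, b}) ?_).trans
        ((ncard_insert_le a {b}).trans (by rw [ncard_singleton]))
      rintro x ⟨rfl | rfl | h, hx⟩
      · exact Or.inl rfl
      · exact Or.inr rfl
      · exact absurd h hx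
    have hne : support (W a) ≠ support V := fun h =>
      (h.subset (hWf a ha hca) : V a ≠ 0) hba'
    obtain ⟨Z, hZ, hZc, hZg⟩ := hC _ hWa V hV hne hnull c (by rw [hVc, neg_neg]) (hWc a ha hca)
    have hZa : Z a = W a a := by
      have := hZg a
      rwa [hba', hadd_zero] at this
    have hZb : Z b = V b := by
      have := hZg b
      rwa [hab', zero_hadd] at this
    have hZK : support Z ∩ K = {a, b} := by
      apply subset_antisymm
      · rintro x ⟨hx, hxK⟩
        rcases mem_union_of_mem_hadd (hZg x) hx with h | h
        · rcases hWaK.subset ⟨h, hxK⟩ with rfl | h'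
          · exact absurd hZc hx
          · exact Or.inl h'
        · rcases hWbK.subset ⟨hVs.subset h, hxK⟩ with rfl | h'
          · exact absurd hZc hx
          · exact Or.inr h'
      · refine pair_subset ⟨?_, ha⟩ ⟨?_, hb⟩
        · rw [mem_support, hZa]
          exact hWf a ha hca
        · rw [mem_support, hZb]
          exact hVs.symm.subset (hWf b hb hcb)
    have h := mul_eq_mul_of_inter_eq_pair hU hC hK hab hX hZ hXK hZK
    rw [hZa, hZb, hVg, neg_div, neg_mul, neg_mul] at h
    rw [hyf a ha hca, hyf b hb hcb, mul_neg, mul_neg, neg_neg]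
    have h1 := hWc a ha hca
    have h2 := hWf a ha hca
    have h3 := hWc b hb hcb
    have h4 := hWf b hb hcb
    have h5 : X b = -(W a c / W b c * W b b * X a) / W a a := by
      rw [← h, mul_div_cancel_right₀ _ h2]
    rw [h5, neg_div, neg_mul, neg_neg]
    field_simp

theorem inter_eq_empty_or_pair (hC : U.IsCircuit (support X)) (hK : U.IsCocircuit (support Y))
    (h : (support X ∩ support Y).ncard ≤ 2) :
    support X ∩ support Y = ∅ ∨ ∃ e f, e ≠ f ∧ support X ∩ support Y = {e, f} := by
  rcases Nat.lt_or_ge (support X ∩ support Y).ncard 2 with hlt | hge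
  · left
    rcases Nat.lt_succ_iff_lt_or_eq.1 hlt with h0 | h1
    · rwa [Nat.lt_one_iff, ncard_eq_zero] at h0
    · obtain ⟨a, ha⟩ := ncard_eq_one.1 h1
      exact absurd ha (hC.inter_isCocircuit_ne_singleton hK)
  · right
    exact ncard_eq_two.1 (le_antisymm h hge)

/-- Vectors with the same cocircuit as support that are orthogonal to the circuits meeting it in at
most two elements are proportional. -/
theorem IsSignature.exists_eq_mul (hU : IsSignature U C) {Y' : E → F}
    (hK : U.IsCocircuit (support Y)) (hs : support Y = support Y')
    (h : ∀ X ∈ C, (support X ∩ support Y).ncard ≤ 2 → Orthogonal τ X Y)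
    (h' : ∀ X ∈ C, (support X ∩ support Y').ncard ≤ 2 → Orthogonal τ X Y') :
    ∃ a : F, a ≠ 0 ∧ Y = fun e => a * Y' e := by
  obtain ⟨c, hc⟩ := hK.nonempty
  have hc' : Y' c ≠ 0 := hs.subset hc
  refine ⟨Y c / Y' c, div_ne_zero hc hc', ?_⟩
  funext f
  by_cases hf : f ∈ support Y
  · by_cases hcf : c = f
    · subst hcf
      exact (div_mul_cancel₀ _ hc').symm
    obtain ⟨I, hI⟩ := exists_isBasis_compl hU (support Y)
    obtain ⟨X, hX, -, hXK⟩ := hU.exists_inter_eq_pair hK hI hc hf hcf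
    have hXf : X f ≠ 0 := (hXK.symm.subset (Or.inr rfl)).1
    have hcard : (support X ∩ support Y).ncard ≤ 2 := by
      rw [hXK, ncard_pair hcf]
    have h1 := (orthogonal_iff_of_inter_subset_pair hcf hXK.subset).1 (h X hX hcard)
    rw [hs] at hXK hcard
    have h2 := (orthogonal_iff_of_inter_subset_pair hcf hXK.subset).1 (h' X hX hcard)
    -- Both vectors are compared through the same circuit `X`, which meets their support in `{c,
    -- f}`.
    have h3 : τ.toFun (Y f * Y' c) = τ.toFun (Y c * Y' f) := by
      rw [τ.toFun_mul, τ.toFun_mul]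
      apply mul_left_cancel₀ hXf
      rw [← mul_assoc, h1, mul_left_comm, h2, neg_mul, mul_neg]
      ac_rfl
    have h4 := congrArg τ.toFun h3
    rw [τ.invol, τ.invol] at h4
    rw [div_mul_eq_mul_div, ← h4, mul_div_cancel_right₀ _ hc']
  · have hf' : f ∉ support Y' := hs ▸ hf
    rw [notMem_support.1 hf, notMem_support.1 hf', mul_zero]

/-- The signature of the dual matroid determined by a signature with pair elimination. -/
def dualSignature (τ : HyperfieldInvolution F) (U : Matroid E) (C : Set (E → F)) : Set (E → F) :=
  {Y | U.IsCocircuit (support Y) ∧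
    ∀ X ∈ C, (support X ∩ support Y).ncard ≤ 2 → Orthogonal τ X Y}

theorem isSignature_dualSignature (τ : HyperfieldInvolution F) (hU : IsSignature U C)
    (hC : HasPairElimination U C) : IsSignature (Matroid.dual U) (dualSignature τ U C) where
  zero_notMem h := by
    refine h.1.nonempty.ne_empty ?_
    ext
    simp
  smul_mem Y hY a ha := by
    refine ⟨(support_const_mul ha Y).symm ▸ hY.1, fun X hX hcard => ?_⟩
    rw [support_const_mul ha Y] at hcard
    exact (hY.2 X hX hcard).const_mul_right a
  incomparable Y hY Y' hY' hs :=
    hU.exists_eq_mul hY.1 (hY.1.isCircuit.eq_of_subset_isCircuit hY'.1.isCircuit hs) hY.2 hY'.2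
  ground_eq := hU.ground_eq
  isCircuit_iff A := by
    constructor
    · intro hA
      obtain ⟨Y, hYA, hY⟩ := exists_orthogonal_of_isCocircuit τ hU hC (K := A) hA
      subst hYA
      refine ⟨Y, ⟨hA, fun X hX hcard => ?_⟩, rfl⟩
      rcases inter_eq_empty_or_pair (hU.isCircuit hX) hA hcard with h | ⟨e, f, hef, h⟩
      · exact orthogonal_of_disjoint h
      · exact (orthogonal_iff_of_inter_subset_pair hef h.subset).2 (hY X hX e f hef h)
    · rintro ⟨Y, hY, rfl⟩
      exact hY.1

theorem hypersum_succ {k : ℕ} (g : Fin (k + 1) → F) :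
    hypersum g = (single (g 0) + ∑ i : Fin k, single (g i.succ)).toSet := by
  rw [hypersum_eq_sum, Fin.sum_univ_succ]

theorem sum_single_eq_zero {ι : Type*} {s : Finset ι} {g : ι → F} (h : ∀ i ∈ s, g i = 0) :
    ∑ i ∈ s, single (g i) = 0 :=
  Finset.sum_eq_zero fun i hi => by rw [h i hi, single_zero]

/-- Write the common support as `g, h, e₁, …, e_k`. Circuits `W i` meeting the cocircuit in `{g, e
i}` and cancelling `X` at `e i` allow all `e i` to be eliminated. The resulting `Z` meets it inside
`{g, h}`, and `Z g ∈ X g ⊞ ⊞ᵢ W i g`, multiplied by `τ (Y g)`, becomes the required relation through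
two-term orthogonality of `Z` and the `W i`. -/
theorem orthogonal_of_hasElimination (hU : IsSignature U C) (hK : U.IsCocircuit (support Y))
    (h2 : ∀ X ∈ C, (support X ∩ support Y).ncard ≤ 2 → Orthogonal τ X Y) {k : ℕ}
    (hC : HasElimination U C k) (hX : X ∈ C) (hcard : (support X ∩ support Y).ncard = k + 2) :
    Orthogonal τ X Y := by
  classical
  obtain ⟨g, hg, h, hh, hgh⟩ := (one_lt_ncard (s := support X ∩ support Y)).1 (by lia)
  set S := (support X ∩ support Y) \ {g, h} with hS
  have hScard : S.ncard = k := by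
    rw [hS, ncard_sdiff (pair_subset hg hh), hcard, ncard_pair hgh]
    rfl
  let q : S ≃ Fin k := Finite.equivFinOfCardEq (by rw [Nat.card_coe_set_eq, hScard])
  let e : Fin k → E := fun i => q.symm i
  have heS : ∀ i, e i ∈ S := fun i => (q.symm i).2
  have heinj : Injective e := Subtype.val_injective.comp q.symm.injective
  have hSe : ∀ x ∈ S, ∃ i, e i = x := fun x hx => ⟨q ⟨x, hx⟩, by simp [e]⟩
  have heX : ∀ i, X (e i) ≠ 0 := fun i => (heS i).1.1
  have heg : ∀ i, g ≠ e i := fun i h => (heS i).2 (Or.inl h.symm)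
  have heh : ∀ i, h ≠ e i := fun i h => (heS i).2 (Or.inr h.symm)
  have hcover : ∀ x ∈ support X ∩ support Y, x = g ∨ x = h ∨ ∃ i, e i = x := by
    intro x hx
    by_cases hx' : x ∈ ({g, h} : Set E)
    · rcases hx' with h' | h'
      · exact Or.inl h'
      · exact Or.inr (Or.inl h')
    · exact Or.inr (Or.inr (hSe x ⟨hx, hx'⟩))
  obtain ⟨I, hI, hXI⟩ := exists_isBasis_compl_of_isCircuit hU.ground_eq (hU.isCircuit hX) hg.1 hg.2
  have hW : ∀ i, ∃ W ∈ C, support W ⊆ insert (e i) (insert g I) ∧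
      support W ∩ support Y = {g, e i} ∧ W (e i) = -X (e i) := by
    intro i
    obtain ⟨W, hW, hWs, hWK⟩ := hU.exists_inter_eq_pair hK hI hg.2 (heS i).1.2 (heg i)
    obtain ⟨W', hW', hs, hc, -⟩ := hU.exists_rescale hW
      (hWK.symm.subset (Or.inr rfl)).1 (neg_eq_zero_iff'.not.2 (heX i))
    exact ⟨W', hW', hs ▸ hWs, hs ▸ hWK, hc⟩
  choose W hWC hWs hWK hWe using hW
  have hWh : ∀ i, W i h = 0 := by
    intro i
    by_contra h0
    rcases (hWK i).subset ⟨h0, hh.2⟩ with h' | h'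
    · exact hgh h'.symm
    · exact heh i h'
  -- All supports lie in the base `insert g I` together with the `k + 1` elements `h` and `e i`,
  -- which bounds the nullity.
  obtain ⟨Z, hZ, hZe, hZg⟩ := hC (Fin.cons X W) (Fin.cases hX hWC) (by
      have hsub : ⋃ i, support ((Fin.cons X W : Fin (k + 1) → E → F) i) ⊆
          insert h (range e) ∪ insert g I := by
        refine iUnion_subset (Fin.cases (fun x hx => ?_) fun i x hx => ?_)
        · by_cases hxY : x ∈ support Y
          · rcases hcover x ⟨hx, hxY⟩ with h' | h' | ⟨i, h'⟩
            · exact Or.inr (Or.inl h')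
            · exact Or.inl (Or.inl h')
            · exact Or.inl (Or.inr ⟨i, h'⟩)
          · exact Or.inr (Or.inr (hXI ⟨hx, hxY⟩))
        · rcases hWs i hx with h' | h'
          · exact Or.inl (Or.inr ⟨i, h'.symm⟩)
          · exact Or.inr h'
      refine (nullity_mono hU.ground_eq hsub).trans ((nullity_le_ncard_diff hU.ground_eq
        (isBase_insert_of_isBasis_compl hU.ground_eq hK hI hg.2).indep subset_union_right).trans ?_)
      refine (ncard_le_ncard (t := insert h S) ?_).trans ((ncard_insert_le h S).trans (by lia))
      rintro x ⟨(h' | ⟨i, rfl⟩) | h', hx⟩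
      · exact Or.inl h'
      · exact Or.inr (heS i)
      · exact absurd h' hx)
    (fun hsub => by
      obtain ⟨i, hi⟩ := mem_iUnion.1 (hsub hh.1)
      exact hi (hWh i))
    e (fun i => ⟨by simp [hWe], heX i⟩)
    (fun i j hij hmem => by
      rcases (hWK j).subset ⟨hmem, (heS i).1.2⟩ with h' | h'
      · exact heg i h'.symm
      · exact hij (heinj h').symm)
  simp only [hypersum_succ, Fin.cons_zero, Fin.cons_succ] at hZg
  have hZh : Z h = X h := by
    have := hZg h
    rwa [sum_single_eq_zero fun i _ => hWh i, add_zero, mem_single] at this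
  have hZs : ∀ x, Z x ≠ 0 → x ∈ support X ∨ ∃ i, x ∈ support (W i) := by
    intro x hx
    by_contra! hcon
    have := hZg x
    rw [notMem_support.1 hcon.1, sum_single_eq_zero fun i _ => notMem_support.1 (hcon.2 i),
      single_zero, add_zero, mem_zero_iff] at this
    exact hx this
  have hZK : support Z ∩ support Y ⊆ {h, g} := by
    rintro x ⟨hx, hxY⟩
    rcases hZs x hx with h' | ⟨i, h'⟩
    · rcases hcover x ⟨h', hxY⟩ with h' | h' | ⟨i, rfl⟩
      · exact Or.inr h'
      · exact Or.inl h'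
      · exact absurd (hZe i) hx
    · rcases (hWK i).subset ⟨h', hxY⟩ with h' | rfl
      · exact Or.inr h'
      · exact absurd (hZe i) hx
  have hZ2 := (orthogonal_iff_of_inter_subset_pair hgh.symm hZK).1
    (h2 Z hZ ((ncard_le_ncard hZK).trans (ncard_pair hgh.symm).le))
  have hW2 : ∀ i, W i g * τ.toFun (Y g) = X (e i) * τ.toFun (Y (e i)) := by
    intro i
    have := (orthogonal_iff_of_inter_subset_pair (heg i).symm (pair_comm g (e i) ▸ (hWK i).subset)).1
      (h2 _ (hWC i) ((hWK i) ▸ (ncard_pair (heg i)).le))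
    rw [this, hWe, neg_mul, neg_neg]
  have hsub : support X ∩ support Y ⊆ ↑(insert h (insert g (Finset.univ.image e))) := by
    intro x hx
    rcases hcover x hx with h' | h' | ⟨i, h'⟩
    · simp [h']
    · simp [h']
    · simp [← h']
  rw [orthogonal_iff_sum hsub, Finset.sum_insert (by simpa [hgh.symm] using fun i => (heh i).symm),
    Finset.sum_insert (by simpa using fun i => (heg i).symm),
    Finset.sum_image fun i _ j _ hij => heinj hij, zero_mem_single_add, ← hZh, ← hZ2]
  have := hZg g
  have h3 : Z g ∈ (∑ i : Fin (k + 1),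
      single ((Fin.cons (X g) fun i => W i g : Fin (k + 1) → F) i)).toSet := by
    rw [Fin.sum_univ_succ]
    simpa using this
  have h4 := mul_mem_sum (τ.toFun (Y g)) h3
  rw [Fin.sum_univ_succ] at h4
  simp only [Fin.cons_zero, Fin.cons_succ, mul_comm (τ.toFun (Y g)), hW2] at h4
  exact h4

/-- Choose `z` in the support of `X 0` only. Removing `z` and the `e i` from the union `A` leaves an
independent set `T`, and `Z` is the fundamental circuit of `z` over `T`, scaled to agree with `X 0`
at `z`. At `g ∈ T`, a cocircuit meeting `T` only in `g` meets `A` in at most `k + 2` elements, and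
its orthogonality relations yield the hypersum condition. -/
theorem hasElimination_of_orthogonal (hU : IsSignature U C) (hD : IsSignature (Matroid.dual U) D)
    {k : ℕ} (horth : ∀ X ∈ C, ∀ Y ∈ D, (support X ∩ support Y).ncard ≤ k + 2 → Orthogonal τ X Y) :
    HasElimination U C k := by
  classical
  intro X hX hnull hns e he he'
  obtain ⟨z, hz, hzX⟩ := not_subset.1 hns
  have hzX' : ∀ i : Fin k, X i.succ z = 0 := fun i => by
    by_contra h
    exact hzX (mem_iUnion.2 ⟨i, h⟩)
  set A := ⋃ i, support (X i) with hA
  have hXA : ∀ i, support (X i) ⊆ A := fun i => subset_iUnion (fun i => support (X i)) i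
  have heX : ∀ i, X i.succ (e i) ≠ 0 := fun i h => by
    have := (he i).1
    rw [h, neg_zero_eq] at this
    exact (he i).2 this
  have heinj : Injective e := by
    intro i j hij
    by_contra hne
    exact he' i j (Ne.symm hne) (hij ▸ heX j)
  have hez : ∀ i, e i ≠ z := fun i h => heX i (h ▸ hzX' i)
  have hej : ∀ i j, j ≠ i → X j.succ (e i) = 0 := fun i j hij => notMem_support.1 (he' i j hij)
  set R := insert z (range e) with hR
  have hRcard : R.ncard = k + 1 := by
    rw [hR, ncard_insert_of_notMem (by rintro ⟨i, hi⟩; exact hez i hi), ← image_univ,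
      ncard_image_of_injective _ heinj, ncard_univ, Nat.card_fin]
  have hRA : R ⊆ A := by
    rintro x (rfl | ⟨i, rfl⟩)
    · exact hXA 0 hz
    · exact hXA 0 (he i).2
  set T := A \ R with hT
  have hTA : T ⊆ A := sdiff_subset
  have hground : ∀ B : Set E, B ⊆ U.E := fun B => hU.ground_eq ▸ subset_univ B
  have hTcl : T ⊆ U.closure T := U.subset_closure T (hground T)
  have hecl : ∀ i, e i ∈ U.closure T := by
    intro i
    refine U.closure_subset_closure (fun x hx => ?_)
      ((hU.isCircuit (hX i.succ)).mem_closure_sdiff_singleton_of_mem (heX i))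
    refine ⟨hXA _ hx.1, ?_⟩
    rintro (rfl | ⟨j, rfl⟩)
    · exact hx.1 (hzX' i)
    · exact hx.1 (hej j i fun h => hx.2 (h ▸ rfl))
  have hzcl : z ∈ U.closure T := by
    have h1 : support (X 0) \ {z} ⊆ U.closure T := by
      rintro x ⟨hx, hxz⟩
      by_cases hxR : x ∈ R
      · rcases hxR with h | ⟨i, rfl⟩
        · exact absurd h hxz
        · exact hecl i
      · exact hTcl ⟨hXA _ hx, hxR⟩
    have h2 := U.closure_subset_closure h1
      ((hU.isCircuit (hX 0)).mem_closure_sdiff_singleton_of_mem hz)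
    rwa [Matroid.closure_closure] at h2
  have hAcl : A ⊆ U.closure T := by
    intro x hx
    by_cases hxR : x ∈ R
    · rcases hxR with rfl | ⟨i, rfl⟩
      · exact hzcl
      · exact hecl i
    · exact hTcl ⟨hx, hxR⟩
  -- `T` spans `A` and omits `k + 1` elements, at least the nullity of `A`.
  have hTi : U.Indep T := indep_of_nullity_le hU.ground_eq hTA hAcl
    (by rwa [hT, sdiff_sdiff_cancel_left hRA, hRcard])
  have hzT : z ∉ T := fun h => h.2 (Or.inl rfl)
  have heT : ∀ i, e i ∉ T := fun i h => h.2 (Or.inr ⟨i, rfl⟩)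
  obtain ⟨Z₀, hZ₀, hZ₀s⟩ := hU.exists_of_isCircuit (hTi.fundCircuit_isCircuit hzcl hzT)
  obtain ⟨Z, hZ, hZs, hZz, -⟩ := hU.exists_rescale hZ₀
    (show z ∈ support Z₀ from hZ₀s ▸ U.mem_fundCircuit z T) hz
  have hZT : support Z ⊆ insert z T := by
    rw [hZs, hZ₀s]
    exact U.fundCircuit_subset_insert z T
  have hZe : ∀ i, Z (e i) = 0 := fun i => by
    by_contra h
    rcases hZT h with h' | h'
    · exact hez i h'
    · exact heT i h'
  have hZA : support Z ⊆ A := hZT.trans (insert_subset (hRA (Or.inl rfl)) hTA)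
  refine ⟨Z, hZ, hZe, fun g => ?_⟩
  rw [hypersum_succ]
  by_cases hgA : g ∈ A
  swap
  · rw [notMem_support.1 fun h => hgA (hXA 0 h), notMem_support.1 fun h => hgA (hZA h),
      sum_single_eq_zero fun i _ => notMem_support.1 fun h => hgA (hXA _ h), add_zero]
    rfl
  by_cases hgR : g ∈ R
  · rcases hgR with rfl | ⟨j, rfl⟩
    · rw [hZz, sum_single_eq_zero fun i _ => hzX' i, add_zero]
      rfl
    · rw [hZe, Finset.sum_eq_single j (fun i _ hij => by rw [hej j i hij, single_zero])
        (fun h => absurd (Finset.mem_univ j) h), toSet_add_single, zero_mem_hadd_iff, (he j).1,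
        neg_neg]
  have hgT : g ∈ T := ⟨hgA, hgR⟩
  obtain ⟨K, hK, hKT⟩ := hTi.exists_isCocircuit_inter_eq_mem hgT
  obtain ⟨Y, hY, rfl⟩ := hD.exists_of_isCircuit hK
  have hgY : g ∈ support Y := (hKT.symm.subset rfl).1
  have hAY : A ∩ support Y ⊆ insert g R := by
    rintro x ⟨hx, hxY⟩
    by_cases hxR : x ∈ R
    · exact Or.inr hxR
    · exact Or.inl (hKT.subset ⟨hxY, hx, hxR⟩)
  have horth' : ∀ V ∈ C, support V ⊆ A → Orthogonal τ V Y := by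
    intro V hV hVA
    refine horth V hV Y hY ((ncard_le_ncard ((inter_subset_inter_left _ hVA).trans hAY)).trans ?_)
    exact (ncard_insert_le g R).trans (by rw [hRcard])
  have hge : ∀ i, g ≠ e i := fun i h => hgR (Or.inr ⟨i, h.symm⟩)
  have hgz : g ≠ z := fun h => hgR (Or.inl h)
  have h1 : ∀ i, X (Fin.succ i) g * τ.toFun (Y g) = X 0 (e i) * τ.toFun (Y (e i)) := by
    intro i
    have hsub : support (X i.succ) ∩ support Y ⊆ {e i, g} := by
      rintro x ⟨hx, hxY⟩
      rcases hAY ⟨hXA _ hx, hxY⟩ with h | rfl | ⟨j, rfl⟩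
      · exact Or.inr h
      · exact absurd (hzX' i) hx
      · by_cases hij : i = j
        · exact Or.inl (hij ▸ rfl)
        · exact absurd (hej j i hij) hx
    rw [(orthogonal_iff_of_inter_subset_pair (hge i).symm hsub).1 (horth' _ (hX _) (hXA _)),
      (he i).1, neg_mul]
  have h2 : Z g * τ.toFun (Y g) = -(X 0 z * τ.toFun (Y z)) := by
    have hsub : support Z ∩ support Y ⊆ {z, g} := by
      rintro x ⟨hx, hxY⟩
      rcases hZT hx with h | h
      · exact Or.inl h
      · exact Or.inr (hKT.subset ⟨hxY, h⟩)
    rw [(orthogonal_iff_of_inter_subset_pair hgz.symm hsub).1 (horth' _ hZ hZA), hZz]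
  have h3 := horth' _ (hX 0) (hXA 0)
  have hsub : support (X 0) ∩ support Y ⊆ ↑(insert z (insert g (Finset.univ.image e))) := by
    intro x hx
    rcases hAY ⟨hXA 0 hx.1, hx.2⟩ with h | h | ⟨i, h⟩
    · simp [h]
    · simp [h]
    · simp [← h]
  rw [orthogonal_iff_sum hsub, Finset.sum_insert (by simpa [hgz.symm] using hez),
    Finset.sum_insert (by simpa using fun i => (hge i).symm),
    Finset.sum_image fun i _ j _ hij => heinj hij, zero_mem_single_add, ← h2] at h3
  simp only [← h1] at h3
  have h4 : Z g * τ.toFun (Y g) ∈ (∑ i, single (X i g * τ.toFun (Y g))).toSet := by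
    rwa [Fin.sum_univ_succ]
  -- All terms of the relation now carry the factor `τ (Y g)`, which is cancelled.
  have h5 := mul_mem_sum (τ.toFun (Y g))⁻¹ h4
  have hne : τ.toFun (Y g) ≠ 0 := τ.toFun_eq_zero.not.2 hgY
  have hcancel : ∀ x, (τ.toFun (Y g))⁻¹ * (x * τ.toFun (Y g)) = x := fun x => by
    rw [mul_comm x, inv_mul_cancel_left₀ hne]
  rw [← Fin.sum_univ_succ fun i => single (X i g)]
  simpa only [hcancel] using h5

end DualPair
end HyperfieldMatroid

namespace HyperfieldMatroid

open Hyperfield HyperSet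

/-! ### Alternating functions and their bases -/

section Alternating

variable {F E : Type*} [Hyperfield F] {r s : ℕ} {φ : (Fin r → E) → F}

/-- The sign of a permutation, as an element of a hyperfield. -/
def hyperSign (F : Type*) [Hyperfield F] (σ : Equiv.Perm (Fin r)) : F :=
  if Equiv.Perm.sign σ = 1 then 1 else -1

theorem hyperSign_ne_zero (σ : Equiv.Perm (Fin r)) : hyperSign F σ ≠ 0 := by
  unfold hyperSign
  split_ifs
  · exact one_ne_zero
  · exact neg_eq_zero_iff'.not.2 one_ne_zero

theorem hyperSign_swap_mul {i j : Fin r} (hij : i ≠ j) (σ : Equiv.Perm (Fin r)) :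
    hyperSign F (Equiv.swap i j * σ) = -hyperSign F σ := by
  unfold hyperSign
  rw [Equiv.Perm.sign_mul, Equiv.Perm.sign_swap hij]
  rcases Int.units_eq_one_or (Equiv.Perm.sign σ) with h | h <;> simp [h]

theorem hyperSign_symm_cycleRange (i : Fin r) :
    hyperSign F i.cycleRange.symm = (-1) ^ (i : ℕ) := by
  unfold hyperSign
  rw [Equiv.Perm.sign_symm, Fin.sign_cycleRange]
  rcases Nat.even_or_odd (i : ℕ) with h | h
  · simp [h.neg_one_pow]
  · simp [h.neg_one_pow]

theorem IsAlternatingNonzero.apply_comp_perm (h : IsAlternatingNonzero φ)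
    (σ : Equiv.Perm (Fin r)) (x : Fin r → E) : φ (x ∘ σ) = hyperSign F σ * φ x := by
  induction σ using Equiv.Perm.swap_induction_on generalizing x with
  | one => simp [hyperSign]
  | swap_mul σ i j hij ih =>
    have h1 : x ∘ (Equiv.swap i j * σ) = (x ∘ Equiv.swap i j) ∘ σ := rfl
    rw [h1, ih, h.swap x i j hij, hyperSign_swap_mul hij, mul_neg, neg_mul]

theorem IsAlternatingNonzero.injective (h : IsAlternatingNonzero φ) {x : Fin r → E}
    (hx : φ x ≠ 0) : Injective x := by
  intro i j hij
  by_contra hne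
  exact hx (h.eq_zero x i j hne hij)

theorem exists_perm_of_range_eq {x y : Fin r → E} (hx : Injective x) (hy : Injective y)
    (h : range x = range y) : ∃ σ : Equiv.Perm (Fin r), y = x ∘ σ := by
  refine ⟨((Equiv.ofInjective y hy).trans (Equiv.setCongr h.symm)).trans
    (Equiv.ofInjective x hx).symm, ?_⟩
  funext i
  simp [Equiv.apply_ofInjective_symm hx]

theorem injective_of_range_eq {x y : Fin r → E} (hx : Injective x) (h : range x = range y) :
    Injective y := by
  have h1 : (range y).ncard = r := by
    rw [← h, ← image_univ, ncard_image_of_injective _ hx, ncard_univ, Nat.card_fin]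
  rw [← injOn_univ]
  refine injOn_of_ncard_image_eq ?_
  rw [image_univ, h1, ncard_univ, Nat.card_fin]

theorem IsAlternatingNonzero.ne_zero_iff (h : IsAlternatingNonzero φ) {x : Fin r → E} :
    φ x ≠ 0 ↔ range x ∈ gpBases φ := by
  refine ⟨fun hx => ⟨x, hx, rfl⟩, ?_⟩
  rintro ⟨y, hy, hyx⟩
  obtain ⟨σ, rfl⟩ := exists_perm_of_range_eq (h.injective hy)
    (injective_of_range_eq (h.injective hy) hyx) hyx
  rw [h.apply_comp_perm]
  exact mul_ne_zero (hyperSign_ne_zero σ) hy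

/-- Moving entry `i` to the front is a cycle of length `i + 1`, of sign `(-1) ^ i`. -/
theorem IsAlternatingNonzero.apply_cons_removeNth {φ : (Fin (s + 1) → E) → F}
    (h : IsAlternatingNonzero φ) (x : Fin (s + 1) → E) (i : Fin (s + 1)) :
    φ (Fin.cons (x i) fun j => x (i.succAbove j)) = (-1) ^ (i : ℕ) * φ x := by
  have h1 := Fin.cons_removeNth_eq_comp_cycleRange_symm x i
  have h2 := h.apply_comp_perm i.cycleRange.symm x
  rw [← h1, hyperSign_symm_cycleRange] at h2
  exact h2

theorem range_cons_removeNth (x : Fin (s + 1) → E) (i : Fin (s + 1)) :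
    insert (x i) (range fun j => x (i.succAbove j)) = range x := by
  have h1 := Fin.cons_removeNth_eq_comp_cycleRange_symm x i
  have h2 : range (x ∘ i.cycleRange.symm) = range x := EquivLike.range_comp _ _
  rw [← h2, ← h1, Fin.range_cons]
  rfl

theorem IsAlternatingNonzero.apply_cons_cons {φ : (Fin (s + 2) → E) → F}
    (h : IsAlternatingNonzero φ) (a b : E) (w : Fin s → E) :
    φ (Fin.cons a (Fin.cons b w : Fin (s + 1) → E)) =
      -φ (Fin.cons b (Fin.cons a w : Fin (s + 1) → E)) := by
  rw [← h.swap _ 0 1 (by simp)]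
  congr 1
  funext i
  refine Fin.cases ?_ (fun i => ?_) i
  · simp
  · refine Fin.cases ?_ (fun i => ?_) i
    · simp
    · rw [comp_apply, Equiv.swap_apply_of_ne_of_ne (by simp [Fin.ext_iff])
        (by simp [Fin.ext_iff])]
      simp

/-- Reordering the tail changes the values at `a` and at `b` by the same sign. -/
theorem IsAlternatingNonzero.mul_eq_mul_of_range_eq {φ : (Fin (s + 1) → E) → F}
    (h : IsAlternatingNonzero φ) (a b : E) {y y' : Fin s → E} (hy : Injective y)
    (hyy' : range y = range y') :
    φ (Fin.cons b y) * φ (Fin.cons a y') = φ (Fin.cons b y') * φ (Fin.cons a y) := by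
  obtain ⟨σ, rfl⟩ := exists_perm_of_range_eq hy (injective_of_range_eq hy hyy') hyy'
  have key : ∀ c : E, (Fin.cons c (y ∘ σ) : Fin (s + 1) → E) =
      (Fin.cons c y : Fin (s + 1) → E) ∘ (Equiv.Perm.decomposeFin.symm (0, σ)) := by
    intro c
    funext i
    refine Fin.cases ?_ (fun i => ?_) i
    · simp
    · simp
  rw [key, key, h.apply_comp_perm, h.apply_comp_perm]
  ac_rfl

/-- In the relation for `(x i, x')` and `x` without `x i`, the first term is `± φ(x') φ(x) ≠ 0`.
Hence some other term is non-zero, and its second factor provides the exchange. -/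
theorem IsStrongGP.exchange {φ : (Fin r → E) → F} (h : IsStrongGP φ) :
    Matroid.ExchangeProperty fun B => B ∈ gpBases φ := by
  rintro _ _ ⟨x, hx, rfl⟩ ⟨x', hx', rfl⟩ a ⟨⟨i, rfl⟩, hi⟩
  cases r with
  | zero => exact i.elim0
  | succ s =>
    have hrel := h.relation s rfl (Fin.cons (x i) x') (fun j => x (i.succAbove j))
    unfold GPRelation at hrel
    rw [hypersum_succ, zero_mem_single_add] at hrel
    by_contra! hcon
    rw [sum_single_eq_zero, mem_zero_iff, neg_eq_zero_iff'] at hrel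
    · simp only [Fin.cons_zero, Fin.succAbove_zero, Fin.cons_succ, Fin.cast_refl, id] at hrel
      rw [h.apply_cons_removeNth] at hrel
      revert hrel
      simp [hx, hx', neg_eq_zero_iff']
    · intro k _
      simp only [Fin.cons_succ, Fin.cast_refl, id]
      by_contra hne
      have h1 := right_ne_zero_of_mul hne
      have hinj := Fin.cons_injective_iff.1 (h.injective h1)
      have hran : range x \ {x i} = range fun j => x (i.succAbove j) := by
        rw [← range_cons_removeNth x i, insert_sdiff_self_of_notMem]
        rintro ⟨j, hj⟩
        exact Fin.succAbove_ne i j (h.injective hx hj)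
      refine hcon (x' k) ⟨⟨k, rfl⟩, fun hk => ?_⟩ ⟨_, h1, ?_⟩
      · by_cases hki : x' k = x i
        · exact hi ⟨k, hki⟩
        · exact hinj.1 (hran.subset ⟨hk, hki⟩)
      · rw [hran, Fin.range_cons]

theorem IsStrongGP.isWeakGP [Finite E] (h : IsStrongGP φ) : IsWeakGP φ :=
  { h.toIsAlternatingNonzero with
    bases := ⟨Matroid.ofIsBaseOfFinite finite_univ (fun B => B ∈ gpBases φ)
      (let ⟨x, hx⟩ := h.nonzero; ⟨_, x, hx, rfl⟩) h.exchange fun _ _ => subset_univ _,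
      rfl, fun _ => Iff.rfl⟩
    relation := fun s hs x y _ => h.relation s hs x y }

end Alternating

end HyperfieldMatroid

namespace HyperfieldMatroid

open Hyperfield HyperSet

/-! ### Circuits of weak Grassmann–Plücker functions -/

section GrassmannPlucker

/-- The chain of ratios `p / q = x' / x = y' / y = p' / q'`, cleared of denominators. -/
theorem mul_eq_mul_of_chain {G : Type*} [CommGroupWithZero G] {p p' q q' x x' y y' : G}
    (hx : x ≠ 0) (hy : y ≠ 0) (h1 : p * x = x' * q) (h2 : x' * y = y' * x)
    (h3 : y' * q' = p' * y) : p * q' = p' * q := by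
  apply mul_right_cancel₀ (mul_ne_zero hx hy)
  calc p * q' * (x * y) = p * x * q' * y := by ac_rfl
    _ = x' * y * q' * q := by rw [h1]; ac_rfl
    _ = y' * q' * x * q := by rw [h2]; ac_rfl
    _ = p' * q * (x * y) := by rw [h3]; ac_rfl

theorem mul_eq_neg_mul_of_chain {G : Type*} [CommGroupWithZero G] [HasDistribNeg G]
    {u v w p q x y z : G} (hx : x ≠ 0) (hy : y ≠ 0) (h1 : u * y = v * z) (h2 : -(w * y) = v * x)
    (h3 : q * x = z * p) : u * p = -(w * q) := by
  apply mul_right_cancel₀ (mul_ne_zero hx hy)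
  calc u * p * (x * y) = u * y * p * x := by ac_rfl
    _ = v * x * (z * p) := by rw [h1]; ac_rfl
    _ = -(w * y * (q * x)) := by rw [← h2, ← h3, neg_mul]
    _ = -(w * q) * (x * y) := by
      rw [neg_mul]
      congr 1
      ac_rfl

theorem isBase_insert_sdiff_of_isCircuit {E : Type*} {U : Matroid E} {B K : Set E} {a b : E}
    (hE : U.E = univ) (hB : U.IsBase B) (hK : U.IsCircuit K) (hKB : K ⊆ insert b B) (ha : a ∈ K)
    (hab : a ≠ b) : U.IsBase (insert b (B \ {a})) := by
  have hbB : b ∉ B := fun h =>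
    hK.not_indep (hB.indep.subset (hKB.trans (insert_subset h subset_rfl)))
  have haB : a ∈ B := (hKB ha).resolve_left hab
  have hcl : b ∈ U.closure B := by
    rw [hB.closure_eq, hE]
    trivial
  rw [hK.eq_fundCircuit_of_subset hB.indep hKB,
    hB.indep.mem_fundCircuit_iff hcl hbB] at ha
  rw [insert_sdiff_singleton_comm hab.symm]
  exact hB.exchange_isBase_of_indep' haB hbB ha

variable {F E : Type*} [Hyperfield F] {r s : ℕ} {U : Matroid E} {K : Set E} {a b c : E}

theorem isCircuit_iff_minimal_gpBases {φ : (Fin r → E) → F} (hE : U.E = univ)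
    (hU : ∀ B, U.IsBase B ↔ B ∈ gpBases φ) :
    Minimal (fun A : Set E => ∀ B ∈ gpBases φ, ¬ A ⊆ B) K ↔ U.IsCircuit K := by
  rw [Matroid.isCircuit_iff_minimal_not_indep (hE ▸ subset_univ K)]
  simp only [Matroid.indep_iff, hU, not_exists, not_and]

theorem IsAlternatingNonzero.ne_zero_iff_isBase {φ : (Fin r → E) → F}
    (hφ : IsAlternatingNonzero φ) (hU : ∀ B, U.IsBase B ↔ B ∈ gpBases φ) {x : Fin r → E} :
    φ x ≠ 0 ↔ U.IsBase (range x) := by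
  rw [hφ.ne_zero_iff, hU]

variable {φ : (Fin (s + 1) → E) → F}

/-- Exchange of an element of a base for an element of a circuit. -/
theorem IsAlternatingNonzero.ne_zero_of_isCircuit (hφ : IsAlternatingNonzero φ) (hE : U.E = univ)
    (hU : ∀ B, U.IsBase B ↔ B ∈ gpBases φ) (hK : U.IsCircuit K) (ha : a ∈ K) (hab : a ≠ b)
    {y : Fin s → E} (hy : φ (Fin.cons a y) ≠ 0) (hKy : K ⊆ insert b (insert a (range y))) :
    φ (Fin.cons b y) ≠ 0 := by
  have h1 := hy
  rw [hφ.ne_zero_iff_isBase hU, Fin.range_cons] at h1 ⊢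
  have h2 := isBase_insert_sdiff_of_isCircuit hE h1 hK hKy ha hab
  rwa [insert_sdiff_self_of_notMem (Fin.cons_injective_iff.1 (hφ.injective hy)).1] at h2

/-- Use the three-term relation for `(a, b, d, w)` and `(d', w)`. Its term omitting `d` contains
`φ(a, b, w)`, which vanishes because `K ⊆ {a, b} ∪ w` is dependent. Two terms remain, so the
relation is an equation. -/
theorem IsWeakGP.mul_eq_mul_of_exchange {φ : (Fin (s + 2) → E) → F} (hφ : IsWeakGP φ)
    (hU : ∀ B, U.IsBase B ↔ B ∈ gpBases φ) (hK : U.IsCircuit K) {d d' : E}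
    {w : Fin s → E} (hd : φ (Fin.cons a (Fin.cons d w : Fin (s + 1) → E)) ≠ 0)
    (hd' : φ (Fin.cons a (Fin.cons d' w : Fin (s + 1) → E)) ≠ 0)
    (hKw : K ⊆ insert a (insert b (range w))) :
    φ (Fin.cons b (Fin.cons d w : Fin (s + 1) → E)) *
        φ (Fin.cons a (Fin.cons d' w : Fin (s + 1) → E)) =
      φ (Fin.cons b (Fin.cons d' w : Fin (s + 1) → E)) *
        φ (Fin.cons a (Fin.cons d w : Fin (s + 1) → E)) := by
  have hA := hφ.toIsAlternatingNonzero
  by_cases hdd : d = d'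
  · rw [hdd]
  have hnot : ∀ x : Fin (s + 2) → E, φ x ≠ 0 → ¬ K ⊆ range x := fun x hx h =>
    hK.not_indep (((hA.ne_zero_iff_isBase hU).1 hx).indep.subset h)
  have hi := Fin.cons_injective_iff.1 (hA.injective hd)
  have hi' := Fin.cons_injective_iff.1 (hA.injective hd')
  have hiw := (Fin.cons_injective_iff.1 hi.2)
  have hiw' := (Fin.cons_injective_iff.1 hi'.2)
  have hn := hnot _ hd
  have hn' := hnot _ hd'
  simp only [Fin.range_cons] at hi hi' hn hn'
  have had : a ≠ d := fun h => hi.1 (Or.inl h)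
  have haw : a ∉ range w := fun h => hi.1 (Or.inr h)
  have had' : a ≠ d' := fun h => hi'.1 (Or.inl h)
  have hbn : ∀ B, ¬ K ⊆ insert a B → range w ⊆ B → b ∉ insert a B := by
    intro B hB hwB hb
    refine hB (hKw.trans (insert_subset (Or.inl rfl) (insert_subset hb ?_)))
    exact hwB.trans (subset_insert _ _)
  have hb := hbn _ hn (subset_insert _ _)
  have hb' := hbn _ hn' (subset_insert _ _)
  have hbw : b ∉ range w := fun h => hb (Or.inr (Or.inr h))
  have hba : a ≠ b := fun h => hb (Or.inl h.symm)
  have hbd : b ≠ d := fun h => hb (Or.inr (Or.inl h))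
  have hbd' : b ≠ d' := fun h => hb' (Or.inr (Or.inl h))
  have hcard : (range (Fin.cons a (Fin.cons b (Fin.cons d w : Fin (s + 1) → E) : Fin (s + 2) → E) :
      Fin (s + 2 + 1) → E) \ range (Fin.cons d' w : Fin (s + 1) → E)).ncard = 3 := by
    simp only [Fin.range_cons]
    rw [ncard_eq_three]
    refine ⟨a, b, d, hba, had, hbd, ?_⟩
    ext x
    have hdw := hiw.1
    simp only [mem_sdiff, mem_insert_iff, mem_singleton_iff, not_or]
    constructor
    · tauto
    · rintro (rfl | rfl | rfl)
      · exact ⟨Or.inl rfl, had', haw⟩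
      · exact ⟨Or.inr (Or.inl rfl), hbd', hbw⟩
      · exact ⟨Or.inr (Or.inr (Or.inl rfl)), hdd, hdw⟩
  have hrel := hφ.relation (s + 1) rfl _ _ hcard
  unfold GPRelation at hrel
  rw [hypersum_succ, Fin.sum_univ_succ, sum_single_eq_zero, add_zero, toSet_add_single,
    zero_mem_hadd_iff] at hrel
  · have e1 : (fun i => (Fin.cons a (Fin.cons b (Fin.cons d w : Fin (s + 1) → E) :
        Fin (s + 2) → E) : Fin (s + 2 + 1) → E) (((0 : Fin (s + 2)).succ).succAbove i)) =
        (Fin.cons a (Fin.cons d w : Fin (s + 1) → E) : Fin (s + 2) → E) := by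
      funext i
      refine Fin.cases ?_ (fun i => ?_) i
      · simp
      · simp
    rw [e1] at hrel
    simp only [Fin.cons_zero, Fin.cons_succ, Fin.succAbove_zero, Fin.cast_refl, id] at hrel
    simp only [Fin.val_succ, Fin.val_zero, zero_add, pow_one, even_two, Even.neg_pow,
      one_add_one_eq_two, one_pow, one_mul, neg_mul, neg_neg] at hrel
    exact hrel.symm.trans (mul_comm _ _)
  · intro k _
    refine Fin.cases ?_ (fun j => ?_) k
    · refine mul_eq_zero_of_left (mul_eq_zero_of_right _ ?_) _
      have e2 : (fun i => (Fin.cons a (Fin.cons b (Fin.cons d w : Fin (s + 1) → E) :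
          Fin (s + 2) → E) : Fin (s + 2 + 1) → E)
            (((0 : Fin (s + 1)).succ.succ : Fin (s + 3)).succAbove i)) =
          (Fin.cons a (Fin.cons b w : Fin (s + 1) → E) : Fin (s + 2) → E) := by
        funext i
        refine Fin.cases ?_ (fun i => Fin.cases ?_ (fun i => ?_) i) i
        · rw [Fin.succ_succAbove_zero]
          simp
        · rw [Fin.succ_succAbove_succ, Fin.succ_succAbove_zero]
          simp
        · rw [Fin.succ_succAbove_succ, Fin.succ_succAbove_succ]
          simp
      rw [e2]
      by_contra h
      refine hnot _ h ?_
      rwa [Fin.range_cons, Fin.range_cons]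
    -- An omitted entry of `w` is repeated in the second factor.
    · refine mul_eq_zero_of_right _ (hA.eq_zero _ 0 j.succ.succ (by simp [Fin.ext_iff]) ?_)
      simp

/-- For `a` and `b` in a circuit, the ratio of `φ(b, y)` and `φ(a, y)` does not depend on `y`. -/
theorem IsWeakGP.mul_eq_mul_of_isCircuit (hφ : IsWeakGP φ)
    (hU : ∀ B, U.IsBase B ↔ B ∈ gpBases φ) (hK : U.IsCircuit K)
    {y' : Fin s → E} (hy' : φ (Fin.cons a y') ≠ 0) (hKy' : K ⊆ insert a (insert b (range y'))) :
    ∀ (n : ℕ) (y : Fin s → E), (range y' \ range y).ncard = n → φ (Fin.cons a y) ≠ 0 →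
      K ⊆ insert a (insert b (range y)) →
      φ (Fin.cons b y) * φ (Fin.cons a y') = φ (Fin.cons b y') * φ (Fin.cons a y) := by
  have hA := hφ.toIsAlternatingNonzero
  have hi' := Fin.cons_injective_iff.1 (hA.injective hy')
  have hcard : ∀ x : Fin s → E, Injective x → (range x).ncard = s := fun x hx => by
    rw [← image_univ, ncard_image_of_injective _ hx, ncard_univ, Nat.card_fin]
  intro n
  induction n with
  | zero =>
    intro y hn hy _
    have hi := Fin.cons_injective_iff.1 (hA.injective hy)
    rw [ncard_eq_zero ((finite_range y').sdiff), sdiff_eq_empty] at hn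
    have hr : range y' = range y := eq_of_subset_of_ncard_le hn
      (by rw [hcard _ hi.2, hcard _ hi'.2]) (finite_range y)
    exact hA.mul_eq_mul_of_range_eq a b hi.2 hr.symm
  | succ n ih =>
    intro y hn hy hKy
    have hi := Fin.cons_injective_iff.1 (hA.injective hy)
    have hne : ¬ range y ⊆ range y' := by
      intro h
      have hr : range y = range y' := eq_of_subset_of_ncard_le h
        (by rw [hcard _ hi.2, hcard _ hi'.2]) (finite_range y')
      simp [hr] at hn
    obtain ⟨_, ⟨j, rfl⟩, hj⟩ := not_subset.1 hne
    have hja : y j ≠ a := fun h => hi.1 ⟨j, h⟩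
    -- Replacing `y j ∉ range y'` by an entry `d'` of `y'` brings `y` closer to `y'` and keeps `K`
    -- covered, as `K` is covered by `a`, `b` and `y'` too.
    obtain ⟨d', ⟨hd'1, hd'2⟩, hd'⟩ := U.isBase_exchange _ _
      ((hA.ne_zero_iff_isBase hU).1 hy) ((hA.ne_zero_iff_isBase hU).1 hy') (y j)
      ⟨by simp [Fin.range_cons], by
        rw [Fin.range_cons]
        rintro (h | h)
        · exact hja h
        · exact hj h⟩
    rw [Fin.range_cons] at hd'1 hd'2 hd'
    have hd'a : d' ≠ a := fun h => hd'2 (Or.inl h)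
    have hd'y' : d' ∈ range y' := hd'1.resolve_left hd'a
    have hd'y : d' ∉ range y := fun h => hd'2 (Or.inr h)
    cases s with
    | zero => exact j.elim0
    | succ t =>
      set w : Fin t → E := fun i => y (j.succAbove i) with hw
      have hyw : insert (y j) (range w) = range y := range_cons_removeNth y j
      have hjw : y j ∉ range w := by
        rintro ⟨i, hi2⟩
        exact Fin.succAbove_ne j i (hi.2 hi2)
      have hyw' : range y \ {y j} = range w := by
        rw [← hyw, insert_sdiff_self_of_notMem hjw]
      have hd1 : φ (Fin.cons a (Fin.cons (y j) w : Fin (t + 1) → E)) ≠ 0 := by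
        rw [hA.ne_zero_iff_isBase hU] at hy ⊢
        rwa [Fin.range_cons, Fin.range_cons, hyw, ← Fin.range_cons]
      have hd2 : φ (Fin.cons a (Fin.cons d' w : Fin (t + 1) → E)) ≠ 0 := by
        rw [hA.ne_zero_iff_isBase hU, Fin.range_cons, Fin.range_cons, insert_comm]
        rwa [← insert_sdiff_singleton_comm hja.symm, hyw'] at hd'
      have hKw : K ⊆ insert a (insert b (range w)) := by
        intro x hx
        rcases hKy hx with h | h | h
        · exact Or.inl h
        · exact Or.inr (Or.inl h)
        · by_cases hxj : x = y j
          · rcases hKy' hx with h | h | h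
            · exact Or.inl h
            · exact Or.inr (Or.inl h)
            · exact absurd (hxj ▸ h) hj
          · exact Or.inr (Or.inr (hyw'.subset ⟨h, hxj⟩))
      have h1 := hA.mul_eq_mul_of_range_eq a b hi.2
        (show range y = range (Fin.cons (y j) w : Fin (t + 1) → E) by rw [Fin.range_cons, hyw])
      have h2 := hφ.mul_eq_mul_of_exchange hU hK hd1 hd2 hKw
      have h3 := ih (Fin.cons d' w) (by
        have : range y' \ range (Fin.cons d' w : Fin (t + 1) → E) =
            (range y' \ range y) \ {d'} := by
          rw [Fin.range_cons, ← hyw']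
          ext x
          simp only [mem_sdiff, mem_insert_iff, mem_singleton_iff]
          grind
        rw [this, ncard_sdiff_singleton_of_mem (show d' ∈ range y' \ range y from ⟨hd'y', hd'y⟩),
          hn]
        rfl) hd2 (by
          rw [Fin.range_cons]
          exact hKw.trans (insert_subset_insert (insert_subset_insert (subset_insert _ _))))
      exact mul_eq_mul_of_chain hd1 hd2 h1 h2 h3

/-- Every circuit supports a vector `X` with `X(a) φ(a, y) = - X(b) φ(b, y)`. -/
theorem IsWeakGP.exists_vector (hφ : IsWeakGP φ) (hE : U.E = univ)
    (hU : ∀ B, U.IsBase B ↔ B ∈ gpBases φ) (hK : U.IsCircuit K) :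
    ∃ X : E → F, support X = K ∧ ∀ a ∈ K, ∀ b ∈ K, a ≠ b → ∀ y : Fin s → E,
      φ (Fin.cons a y) ≠ 0 → K ⊆ insert a (insert b (range y)) →
      X a * φ (Fin.cons a y) = -(X b * φ (Fin.cons b y)) := by
  classical
  have hA := hφ.toIsAlternatingNonzero
  obtain ⟨b, hb⟩ := hK.nonempty
  obtain ⟨B, hB, hKB⟩ := (hK.sdiff_singleton_indep hb).exists_isBase_superset
  obtain ⟨x, hx, rfl⟩ := (hU B).1 hB
  have hY : ∀ a, ∃ y : Fin s → E, a ∈ K → a ≠ b →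
      φ (Fin.cons a y) ≠ 0 ∧ K ⊆ insert a (insert b (range y)) := by
    intro a
    by_cases h : a ∈ K ∧ a ≠ b
    · obtain ⟨i, rfl⟩ := hKB ⟨h.1, h.2⟩
      refine ⟨fun j => x (i.succAbove j), fun _ _ => ⟨?_, ?_⟩⟩
      · rw [hA.apply_cons_removeNth]
        exact mul_ne_zero (pow_ne_zero _ (neg_eq_zero_iff'.not.2 one_ne_zero)) hx
      · rw [insert_comm, range_cons_removeNth]
        intro e he
        by_cases heb : e = b
        · exact Or.inl heb
        · exact Or.inr (hKB ⟨he, heb⟩)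
    · exact ⟨fun _ => b, fun h1 h2 => absurd ⟨h1, h2⟩ h⟩
  choose y hy hKy using hY
  -- Normalised to be 1 at `b`; the value at `a` is read off any tuple `y a`, since the ratio is
  -- independent of it.
  let X : E → F := fun a => if a ∈ K then
    if a = b then 1 else -(φ (Fin.cons b (y a)) / φ (Fin.cons a (y a))) else 0
  have hXb : X b = 1 := by simp [X, hb]
  have hXa : ∀ a ∈ K, a ≠ b → X a = -(φ (Fin.cons b (y a)) / φ (Fin.cons a (y a))) :=
    fun a ha hab => by simp [X, ha, hab]
  have hswap : ∀ {a c : E} {z : Fin s → E}, a ∈ K → a ≠ c → φ (Fin.cons a z) ≠ 0 →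
      K ⊆ insert a (insert c (range z)) → φ (Fin.cons c z) ≠ 0 := by
    intro a c z ha hac hz hKz
    exact hA.ne_zero_of_isCircuit hE hU hK ha hac hz (by rwa [insert_comm])
  have hone : ∀ a ∈ K, a ≠ b → ∀ z : Fin s → E, φ (Fin.cons a z) ≠ 0 →
      K ⊆ insert a (insert b (range z)) →
      X a * φ (Fin.cons a z) = -(X b * φ (Fin.cons b z)) := by
    intro a ha hab z hz hKz
    have h := hφ.mul_eq_mul_of_isCircuit hU hK hz hKz _ (y a) rfl (hy a ha hab) (hKy a ha hab)
    rw [hXa a ha hab, hXb, one_mul, neg_mul, div_mul_eq_mul_div, h,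
      mul_div_cancel_right₀ _ (hy a ha hab)]
  refine ⟨X, ?_, ?_⟩
  · ext a
    rw [mem_support]
    by_cases ha : a ∈ K
    · by_cases hab : a = b
      · simp [hab, hXb, hb]
      · rw [hXa a ha hab, Ne, neg_eq_zero_iff', div_eq_zero_iff]
        simp [hy a ha hab, hswap ha hab (hy a ha hab) (hKy a ha hab), ha]
    · simp [X, ha]
  · intro a ha c hc hac z hz hKz
    by_cases hab : a = b
    · subst hab
      rw [hone c hc hac.symm z (hswap ha hac hz hKz) (by rwa [insert_comm]), neg_neg]
    by_cases hcb : c = b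
    · subst hcb
      exact hone a ha hac z hz hKz
    -- For a pair without `b`, the element `b` must be an entry of `z`. Comparing `a` and `c` each
    -- with `b` over the remaining entries, up to transpositions, gives the relation between them.
    obtain ⟨j, hj⟩ : b ∈ range z :=
      ((hKz hb).resolve_left (Ne.symm hab)).resolve_left (Ne.symm hcb)
    cases s with
    | zero => exact j.elim0
    | succ t =>
      set w : Fin t → E := fun i => z (j.succAbove i) with hw
      have hzw : range z = insert b (range w) := by
        rw [← hj]
        exact (range_cons_removeNth z j).symm
      have hKw : K ⊆ insert a (insert c (insert b (range w))) := hzw ▸ hKz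
      have hab0 : φ (Fin.cons a (Fin.cons b w : Fin (t + 1) → E)) ≠ 0 := by
        rw [hA.ne_zero_iff_isBase hU] at hz ⊢
        rwa [Fin.range_cons, Fin.range_cons, ← hzw, ← Fin.range_cons]
      have hba0 : φ (Fin.cons b (Fin.cons a w : Fin (t + 1) → E)) ≠ 0 := by
        rw [hA.apply_cons_cons]
        exact neg_eq_zero_iff'.not.2 hab0
      have hca0 : φ (Fin.cons c (Fin.cons a w : Fin (t + 1) → E)) ≠ 0 := by
        refine hswap hb (Ne.symm hcb) hba0 ?_
        rw [Fin.range_cons]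
        refine hKw.trans (fun e => ?_)
        simp only [mem_insert_iff]
        tauto
      have hac0 : φ (Fin.cons a (Fin.cons c w : Fin (t + 1) → E)) ≠ 0 := by
        rw [hA.apply_cons_cons]
        exact neg_eq_zero_iff'.not.2 hca0
      have h1 := hone a ha hab _ hac0 (by
        rw [Fin.range_cons]
        refine hKw.trans (fun e => ?_)
        simp only [mem_insert_iff]
        tauto)
      have h2 := hone c hc hcb _ hca0 (by
        rw [Fin.range_cons]
        refine hKw.trans (fun e => ?_)
        simp only [mem_insert_iff]
        tauto)
      have h3 := hA.mul_eq_mul_of_range_eq a c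
        (Fin.cons_injective_iff.1 (hA.injective hz)).2
        (show range z = range (Fin.cons b w : Fin (t + 1) → E) by rw [Fin.range_cons, hzw])
      rw [hA.apply_cons_cons b c, mul_neg, neg_neg] at h1
      rw [hA.apply_cons_cons c a, hA.apply_cons_cons b a, mul_neg, mul_neg, neg_neg] at h2
      exact mul_eq_neg_mul_of_chain hab0 hac0 h1 h2 h3

/-- Bringing the entry of index `j + 1` to the front costs `(-1) ^ j`; the minus sign of the
exchange relation supplies the missing factor. The cast in the hypothesis lets rank `0` be included,
where it is vacuous. -/
theorem IsAlternatingNonzero.mem_gpCircuits {φ : (Fin r → E) → F} {X : E → F}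
    (hφ : IsAlternatingNonzero φ)
    (hU : ∀ B, U.IsBase B ↔ B ∈ gpBases φ) (hE : U.E = univ) (hX : U.IsCircuit (support X))
    (h : ∀ s, ∀ hs : r = s + 1, ∀ a ∈ support X, ∀ b ∈ support X, a ≠ b → ∀ y : Fin s → E,
      φ (fun i => (Fin.cons a y : Fin (s + 1) → E) (Fin.cast hs i)) ≠ 0 →
      support X ⊆ insert a (insert b (range y)) →
      X a * φ (fun i => (Fin.cons a y : Fin (s + 1) → E) (Fin.cast hs i)) =
        -(X b * φ (fun i => (Fin.cons b y : Fin (s + 1) → E) (Fin.cast hs i)))) :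
    X ∈ gpCircuits φ := by
  refine ⟨(isCircuit_iff_minimal_gpBases hE hU).2 hX, fun x hx0 hx hsub i => ?_⟩
  refine Fin.cases ?_ (fun j => ?_) i
  · simp only [Fin.val_zero, pow_zero, one_mul, Fin.succAbove_zero]
    rw [div_self hx0, div_self hx]
  cases r with
  | zero => exact j.elim0
  | succ s =>
    set y : Fin s → E := fun i => x (j.succAbove i).succ with hy
    have e1 : (fun i => x (j.succ.succAbove i)) = (Fin.cons (x 0) y : Fin (s + 1) → E) := by
      funext i
      refine Fin.cases ?_ (fun i => ?_) i
      · simp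
      · simp [hy]
    have e2 : φ (Fin.cons (x j.succ) y) = (-1) ^ (j : ℕ) * φ (fun i => x i.succ) :=
      hφ.apply_cons_removeNth (fun i => x i.succ) j
    have e3 : insert (x j.succ) (range y) = range (fun i => x (Fin.succ i)) :=
      range_cons_removeNth (fun i => x (Fin.succ i)) j
    have hcov : support X ⊆ insert (x j.succ) (insert (x 0) (range y)) := by
      rw [insert_comm, e3]
      intro e he
      by_cases h0 : e = x 0
      · exact Or.inl h0
      · exact Or.inr (hsub ⟨he, h0⟩)
    have hm1 : ((-1 : F) ^ (j : ℕ)) ≠ 0 := pow_ne_zero _ (neg_eq_zero_iff'.not.2 one_ne_zero)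
    have hne : φ (Fin.cons (x j.succ) y) ≠ 0 := by
      rw [e2]
      exact mul_ne_zero hm1 hx
    have hsq : ((-1 : F) ^ (j : ℕ)) * (-1) ^ (j : ℕ) = 1 := by
      rw [← mul_pow, neg_mul_neg, one_mul, one_pow]
    rw [e1, Fin.val_succ, pow_succ, mul_neg_one]
    -- Outside the support both sides vanish: otherwise the circuit would lie in a base.
    by_cases hj : X (x j.succ) = 0
    · have h0 : φ (Fin.cons (x 0) y) = 0 := by
        by_contra h0
        rw [← Ne, hφ.ne_zero_iff_isBase hU, Fin.range_cons] at h0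
        refine hX.not_indep (h0.indep.subset fun e he => ?_)
        rcases hcov he with h' | h'
        · rw [h'] at he
          exact absurd hj he
        · exact h'
      rw [hj, h0]
      simp
    · have hj0 : x j.succ ≠ x 0 := by
        intro h0
        refine hX.not_indep (((hφ.ne_zero_iff_isBase hU).1 hx).indep.subset fun e he => ?_)
        by_cases h1 : e = x 0
        · exact ⟨j, (h1.trans h0.symm).symm⟩
        · exact hsub ⟨he, h1⟩
      have h1 : X (x j.succ) * φ (Fin.cons (x j.succ) y) = -(X (x 0) * φ (Fin.cons (x 0) y)) :=
        h s rfl _ hj _ hx0 hj0 y hne hcov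
      rw [e2] at h1
      rw [div_eq_iff hx0]
      apply mul_right_cancel₀ (mul_ne_zero hm1 hx)
      rw [h1]
      simp only [neg_mul]
      congr 1
      calc _ = X (x 0) * φ (Fin.cons (x 0) y) * 1 := by rw [mul_one]
        _ = X (x 0) * φ (Fin.cons (x 0) y) * (((-1 : F) ^ (j : ℕ)) * (-1) ^ (j : ℕ)) := by rw [hsq]
        _ = X (x 0) * ((φ (Fin.cons (x 0) y) / φ (fun i => x i.succ)) * φ (fun i => x i.succ)) *
              (((-1 : F) ^ (j : ℕ)) * (-1) ^ (j : ℕ)) := by rw [div_mul_cancel₀ _ hx]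
        _ = _ := by ac_rfl

theorem IsWeakGP.exists_mem_gpCircuits {φ : (Fin r → E) → F} (hφ : IsWeakGP φ) (hE : U.E = univ)
    (hU : ∀ B, U.IsBase B ↔ B ∈ gpBases φ) (hK : U.IsCircuit K) :
    ∃ X ∈ gpCircuits φ, support X = K := by
  classical
  cases r with
  | zero =>
    have hs : support (fun e => if e ∈ K then (1 : F) else 0) = K := by
      ext e
      simp
    exact ⟨_, hφ.mem_gpCircuits hU hE (hs.symm ▸ hK) (fun s h => absurd h (by simp)), hs⟩
  | succ s =>
    obtain ⟨X, rfl, hX⟩ := hφ.exists_vector hE hU hK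
    refine ⟨X, hφ.mem_gpCircuits hU hE hK ?_, rfl⟩
    intro s' hs'
    obtain rfl : s = s' := by simpa using hs'
    exact hX

/-! ### Push-forward of Grassmann–Plücker functions -/

section Push

variable {F' : Type*} [Hyperfield F'] (f : HyperfieldHom F F') {φ : (Fin r → E) → F}

theorem gpBases_map (φ : (Fin r → E) → F) :
    gpBases (fun x => f.toFun (φ x)) = gpBases φ := by
  ext B
  simp only [gpBases, mem_ofPred_eq, Ne, f.toFun_eq_zero]

theorem IsAlternatingNonzero.map (h : IsAlternatingNonzero φ) :
    IsAlternatingNonzero fun x => f.toFun (φ x) where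
  nonzero := by
    obtain ⟨x, hx⟩ := h.nonzero
    exact ⟨x, f.toFun_eq_zero.not.2 hx⟩
  swap x i j hij := by rw [h.swap x i j hij, f.toFun_neg]
  eq_zero x i j hij hx := by rw [h.eq_zero x i j hij hx, f.toFun_zero]

theorem GPRelation.map {hs : r = s + 1} {x : Fin (r + 1) → E} {y : Fin s → E}
    (h : GPRelation hs φ x y) : GPRelation hs (fun x => f.toFun (φ x)) x y := by
  have h' := f.map_mem_hypersum h
  rw [f.toFun_zero] at h'
  unfold GPRelation
  convert h' using 2
  funext k
  rw [f.toFun_mul, f.toFun_mul, f.toFun_neg_one_pow]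

theorem IsStrongGP.map (h : IsStrongGP φ) : IsStrongGP fun x => f.toFun (φ x) :=
  { h.toIsAlternatingNonzero.map f with relation := fun s hs x y => (h.relation s hs x y).map f }

theorem IsWeakGP.map (h : IsWeakGP φ) : IsWeakGP fun x => f.toFun (φ x) :=
  { h.toIsAlternatingNonzero.map f with
    bases := by
      rw [gpBases_map]
      exact h.bases
    relation := fun s hs x y hxy => (h.relation s hs x y hxy).map f }

/-- For `⊆`, take a vector of `gpCircuits φ` on the same circuit and scale its image to agree with
`X'` at one element `b`. The ratio formulas for a base containing the rest of the circuit fix all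
other values. -/
theorem gpCircuits_map (hφ : IsWeakGP φ) :
    gpCircuits (fun x => f.toFun (φ x)) = pushSet f (gpCircuits φ) := by
  apply subset_antisymm
  · rintro X' ⟨hmin, hX'⟩
    rw [gpBases_map] at hmin
    obtain ⟨U, hE, hU⟩ := hφ.bases
    have hK := (isCircuit_iff_minimal_gpBases hE hU).1 hmin
    obtain ⟨X, hX, hs⟩ := hφ.exists_mem_gpCircuits hE hU hK
    obtain ⟨b, hb⟩ := hK.nonempty
    obtain ⟨B, hB, hKB⟩ := (hK.sdiff_singleton_indep hb).exists_isBase_superset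
    obtain ⟨x, hx, rfl⟩ := (hU B).1 hB
    have hXb : f.toFun (X b) ≠ 0 := f.toFun_eq_zero.not.2 (hs.symm.subset hb)
    refine ⟨X' b / f.toFun (X b), div_ne_zero hb hXb, X, hX, ?_⟩
    funext e
    by_cases he : e ∈ support X'
    · have hex : ∃ i, (Fin.cons b x : Fin (r + 1) → E) i = e := by
        by_cases heb : e = b
        · exact ⟨0, heb.symm⟩
        · obtain ⟨i, hi⟩ := hKB ⟨he, heb⟩
          exact ⟨i.succ, by simpa using hi⟩
      obtain ⟨i, rfl⟩ := hex
      have h1 := hX' (Fin.cons b x) hb (f.toFun_eq_zero.not.2 hx) hKB i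
      have h2 := hX.2 (Fin.cons b x) (hs.symm.subset hb) hx (hs.symm ▸ hKB) i
      have h3 := congrArg f.toFun h2
      rw [f.toFun_div, f.toFun_mul, f.toFun_neg_one_pow, f.toFun_div, ← h1] at h3
      rw [Fin.cons_zero] at h3
      rw [div_eq_div_iff hXb hb] at h3
      rw [div_mul_eq_mul_div, eq_div_iff hXb, ← h3, mul_comm]
    · have he' : e ∉ support X := hs ▸ he
      rw [notMem_support.1 he, notMem_support.1 he', f.toFun_zero, mul_zero]
  · rintro _ ⟨c, hc, X, hX, rfl⟩
    have hs : support (fun e => c * f.toFun (X e)) = support X := by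
      rw [support_const_mul hc, f.support_comp]
    refine ⟨?_, ?_⟩
    · rw [gpBases_map, hs]
      exact hX.1
    · rw [hs]
      intro x hx0 hx hsub i
      rw [mul_div_mul_left _ _ hc, ← f.toFun_div,
        hX.2 x hx0 (f.toFun_eq_zero.not.1 hx) hsub i, f.toFun_mul, f.toFun_div,
        f.toFun_neg_one_pow]

end Push

end GrassmannPlucker
end HyperfieldMatroid

namespace HyperfieldMatroid

open Hyperfield HyperSet

/-! ### Push-forward of signatures -/

section PushSet

variable {F F' E : Type*} [Hyperfield F] [Hyperfield F'] {U : Matroid E} {C : Set (E → F)}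

theorem supports_pushSet (f : HyperfieldHom F F') (C : Set (E → F)) :
    supports (pushSet f C) = supports C := by
  ext A
  constructor
  · rintro ⟨_, ⟨c, hc, X, hX, rfl⟩, rfl⟩
    exact ⟨X, hX, by rw [support_const_mul hc, f.support_comp]⟩
  · rintro ⟨X, hX, rfl⟩
    exact ⟨_, ⟨1, one_ne_zero, X, hX, rfl⟩, by
      rw [support_const_mul one_ne_zero, f.support_comp]⟩

theorem IsPreCircuitSet.pushSet (h : IsPreCircuitSet C) (f : HyperfieldHom F F') :
    IsPreCircuitSet (pushSet f C) where
  zero_notMem h0 := by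
    refine h.empty_notMem_supports ?_
    rw [← supports_pushSet f]
    exact ⟨_, h0, by ext; simp⟩
  smul_mem := by
    rintro _ ⟨c, hc, X, hX, rfl⟩ a ha
    exact ⟨a * c, mul_ne_zero ha hc, X, hX, by simp only [mul_assoc]⟩
  incomparable := by
    rintro _ ⟨c, hc, X, hX, rfl⟩ _ ⟨d, hd, Y, hY, rfl⟩ hs
    rw [support_const_mul hc, support_const_mul hd, f.support_comp, f.support_comp] at hs
    obtain ⟨a, ha, rfl⟩ := h.incomparable X hX Y hY hs
    refine ⟨c * f.toFun a / d, div_ne_zero (mul_ne_zero hc (f.toFun_eq_zero.not.2 ha)) hd, ?_⟩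
    funext e
    rw [f.toFun_mul, ← mul_assoc, ← mul_assoc, div_mul_cancel₀ _ hd]

theorem IsSignature.pushSet (h : IsSignature U C) (f : HyperfieldHom F F') :
    IsSignature U (pushSet f C) :=
  { h.toIsPreCircuitSet.pushSet f with
    ground_eq := h.ground_eq
    isCircuit_iff := fun A => by rw [h.isCircuit_iff, supports_pushSet] }

end PushSet

/-! ### Dual pairs characterise weak and strong matroids -/

section DualPair

variable {F F' E : Type*} [Hyperfield F] [Hyperfield F'] [Fintype E]
  {τ : HyperfieldInvolution F} {τ' : HyperfieldInvolution F'} {U U' : Matroid E}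
  {C C' D D' : Set (E → F)} {n : ℕ∞}

/-- Signatures of a matroid and of its dual that are orthogonal wherever the supports meet in at
most `n` elements. -/
structure IsDualPair (τ : HyperfieldInvolution F) (n : ℕ∞) (U : Matroid E) (C D : Set (E → F)) :
    Prop where
  left : IsSignature U C
  right : IsSignature (Matroid.dual U) D
  orthogonal : ∀ X ∈ C, ∀ Y ∈ D, ((support X ∩ support Y).ncard : ℕ∞) ≤ n → Orthogonal τ X Y

theorem IsDualPair.symm (h : IsDualPair τ n U C D) : IsDualPair τ n (Matroid.dual U) D C where
  left := h.right
  right := by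
    rw [Matroid.dual_dual]
    exact h.left
  orthogonal Y hY X hX hn := (h.orthogonal X hX Y hY (by rwa [inter_comm])).symm

/-- The matroid and all intersections of supports are unchanged, and orthogonality survives both `f`
and rescaling. -/
theorem IsDualPair.map (h : IsDualPair τ n U C D) (f : HyperfieldHom F F')
    (hf : ∀ x, f.toFun (τ.toFun x) = τ'.toFun (f.toFun x)) :
    IsDualPair τ' n U (pushSet f C) (pushSet f D) where
  left := h.left.pushSet f
  right := h.right.pushSet f
  orthogonal := by
    rintro _ ⟨c, hc, X, hX, rfl⟩ _ ⟨d, hd, Y, hY, rfl⟩ hn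
    rw [support_const_mul hc, support_const_mul hd, f.support_comp, f.support_comp] at hn
    exact (((h.orthogonal X hX Y hY hn).map f hf).const_mul_left c).const_mul_right d

/-- Intersections of size two already fix a vector on a cocircuit up to a scalar, hence `2 ≤ n`. -/
theorem IsDualPair.right_subset (h : IsDualPair τ n U C D) (h' : IsDualPair τ n U C D')
    (hn : 2 ≤ n) : D ⊆ D' := by
  have h2 : ∀ {D : Set (E → F)}, IsDualPair τ n U C D → ∀ Y ∈ D, ∀ X ∈ C,
      (support X ∩ support Y).ncard ≤ 2 → Orthogonal τ X Y := fun h Y hY X hX hcard =>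
    h.orthogonal X hX Y hY (le_trans (by exact_mod_cast hcard) hn)
  intro Y hY
  obtain ⟨Y', hY', hs⟩ := h'.right.exists_of_isCircuit (h.right.isCircuit hY)
  obtain ⟨a, ha, rfl⟩ := h.left.exists_eq_mul (h.right.isCircuit hY) hs.symm (h2 h Y hY)
    (h2 h' Y' hY')
  exact h'.right.smul_mem Y' hY' a ha

theorem IsDualPair.right_unique (h : IsDualPair τ n U C D) (h' : IsDualPair τ n U' C D')
    (hn : 2 ≤ n) : D = D' := by
  obtain rfl := h.left.isUnderlyingMatroid.unique h'.left.isUnderlyingMatroid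
  exact (h.right_subset h' hn).antisymm (h'.right_subset h hn)

theorem IsDualPair.left_unique (h : IsDualPair τ n U C D) (h' : IsDualPair τ n U' C' D)
    (hn : 2 ≤ n) : C = C' :=
  h.symm.right_unique h'.symm hn

theorem IsDualPair.hasElimination (h : IsDualPair τ n U C D) {k : ℕ} (hk : (k : ℕ∞) + 2 ≤ n) :
    HasElimination U C k :=
  hasElimination_of_orthogonal h.left h.right fun X hX Y hY hcard =>
    h.orthogonal X hX Y hY (le_trans (by exact_mod_cast hcard) hk)

theorem IsDualPair.isWeakCircuitSet (h : IsDualPair τ 3 U C D) : IsWeakCircuitSet C :=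
  (h.hasElimination (k := 1) (by norm_num)).isWeakCircuitSet h.left

theorem IsDualPair.isStrongCircuitSet (h : IsDualPair τ ⊤ U C D) : IsStrongCircuitSet C :=
  isStrongCircuitSet_of_hasElimination h.left fun _ => h.hasElimination le_top

theorem isDualPair_dualSignature (τ : HyperfieldInvolution F) (hU : IsSignature U C)
    (hP : HasPairElimination U C) (hC : ∀ k : ℕ, (k : ℕ∞) + 2 ≤ n → HasElimination U C k) :
    IsDualPair τ n U C (dualSignature τ U C) where
  left := hU
  right := isSignature_dualSignature τ hU hP
  orthogonal X hX Y hY hn := by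
    rcases le_total (support X ∩ support Y).ncard 2 with hle | hge
    · exact hY.2 X hX hle
    · obtain ⟨k, hk⟩ := Nat.exists_eq_add_of_le' hge
      rw [hk] at hn
      exact orthogonal_of_hasElimination hU hY.1 hY.2 (hC k (by exact_mod_cast hn)) hX hk

theorem WeakMatroid.exists_isDualPair (M : WeakMatroid F E) (τ : HyperfieldInvolution F) :
    ∃ U, IsDualPair τ 3 U M.circuits (M.cocircuits τ) := by
  obtain ⟨U, hU⟩ := M.isCircuitSet.exists_isSignature
  have hP := M.isCircuitSet.hasPairElimination hU
  have h : IsDualPair τ 3 U M.circuits (dualSignature τ U M.circuits) := by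
    refine isDualPair_dualSignature τ hU hP fun k hk => ?_
    have hk' : k + 2 ≤ 3 := by exact_mod_cast hk
    rcases (by lia : k = 0 ∨ k = 1) with rfl | rfl
    -- For `k = 0` nothing is eliminated and `Z = X 0`.
    · intro X hX _ _ _ _ _
      refine ⟨X 0, hX 0, fun i => i.elim0, fun g => ?_⟩
      rw [hypersum_succ, Finset.univ_eq_empty, Finset.sum_empty, add_zero]
      rfl
    · exact hP.hasElimination_one
  refine ⟨U, ?_⟩
  convert h using 1
  ext Y
  constructor
  · rintro ⟨⟨U', hU', hY⟩, horth⟩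
    obtain rfl := hU'.unique hU.isUnderlyingMatroid
    exact ⟨hY, fun X hX hcard => horth X hX (hcard.trans (by norm_num))⟩
  · intro hY
    exact ⟨⟨U, hU.isUnderlyingMatroid, hY.1⟩, fun X hX hcard =>
      h.orthogonal X hX Y hY (by exact_mod_cast hcard)⟩

/-- The support of a non-zero vector orthogonal to all circuits contains a cocircuit. -/
theorem IsSignature.exists_isCocircuit_subset (hU : IsSignature U C) {Y : E → F} (hY : Y ≠ 0)
    (h : ∀ X ∈ C, Orthogonal τ X Y) : ∃ K ⊆ support Y, U.IsCocircuit K := by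
  -- If the support were coindependent, some circuit would meet it in a single element,
  -- contradicting orthogonality.
  by_cases hi : U.dual.Indep (support Y)
  · obtain ⟨e, he⟩ := support_nonempty_iff.2 hY
    obtain ⟨A, hA, hAY⟩ := hi.exists_isCocircuit_inter_eq_mem he
    rw [Matroid.dual_isCocircuit_iff] at hA
    obtain ⟨X, hX, rfl⟩ := hU.exists_of_isCircuit hA
    exact absurd hAY ((h X hX).inter_ne_singleton e)
  · have hd : U.dual.Dep (support Y) := ⟨hi, hU.ground_eq ▸ subset_univ _⟩
    obtain ⟨K, hKY, hK⟩ := hd.exists_isCircuit_subset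
    exact ⟨K, hKY, hK⟩

/-- The dual signature is orthogonal to all circuits, and every non-zero orthogonal vector has a
cocircuit in its support. Hence the vectors of minimal support are exactly the dual signature. -/
theorem StrongMatroid.exists_isDualPair (M : StrongMatroid F E) (τ : HyperfieldInvolution F) :
    ∃ U, IsDualPair τ ⊤ U M.circuits (M.cocircuits τ) := by
  obtain ⟨U, hU⟩ := M.isCircuitSet.isWeakCircuitSet.exists_isSignature
  have hP := M.isCircuitSet.isWeakCircuitSet.hasPairElimination hU
  have h : IsDualPair τ ⊤ U M.circuits (dualSignature τ U M.circuits) :=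
    isDualPair_dualSignature τ hU hP fun k _ => M.isCircuitSet.hasElimination hU k
  have hmem : ∀ Y ∈ dualSignature τ U M.circuits,
      Y ∈ orthogonalComplement τ M.circuits \ {fun _ => 0} := by
    intro Y hY
    refine ⟨fun X hX => (h.orthogonal X hX Y hY le_top).symm, fun h0 => ?_⟩
    rw [mem_singleton_iff] at h0
    exact h.right.zero_notMem (h0 ▸ hY)
  have hsub : ∀ Y ∈ orthogonalComplement τ M.circuits \ {fun _ => 0},
      ∃ Y' ∈ dualSignature τ U M.circuits, support Y' ⊆ support Y := by
    rintro Y ⟨hY, hY0⟩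
    obtain ⟨K, hK, hKc⟩ := hU.exists_isCocircuit_subset (τ := τ) (Y := Y) hY0
      fun X hX => (hY X hX).symm
    obtain ⟨Y', hY', rfl⟩ := h.right.exists_of_isCircuit hKc
    exact ⟨Y', hY', hK⟩
  refine ⟨U, ?_⟩
  convert h using 1
  ext Y
  constructor
  · rintro ⟨hY, hmin⟩
    obtain ⟨Y', hY', hs⟩ := hsub Y hY
    refine ⟨?_, fun X hX _ => (hY.1 X hX).symm⟩
    rw [← hmin Y' (hmem Y' hY') hs]
    exact hY'.1
  · refine fun hY => ⟨hmem Y hY, fun Y₁ hY₁ hs => hs.antisymm ?_⟩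
    obtain ⟨Y', hY', hs'⟩ := hsub Y₁ hY₁
    rw [← (h.right.isCircuit hY').eq_of_subset_isCircuit (h.right.isCircuit hY) (hs'.trans hs)]
    exact hs'

end DualPair

end HyperfieldMatroid

end

/-! ### Push-forward of matroids and their duals -/

theorem corollary4p8 {F F' E : Type*} [Hyperfield F] [Hyperfield F'] [Fintype E]
    (τ : HyperfieldInvolution F) (τ' : HyperfieldInvolution F')
    (f : HyperfieldHom F F') (hf : ∀ x, f.toFun (τ.toFun x) = τ'.toFun (f.toFun x)) :
    (∀ M : HyperfieldMatroid.StrongMatroid F E,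
      ∃ N : HyperfieldMatroid.StrongMatroid F' E,
        (∀ P : HyperfieldMatroid.StrongMatroid F' E,
          P.circuits = HyperfieldMatroid.pushSet f M.circuits ↔ P = N) ∧
        (∀ P : HyperfieldMatroid.StrongMatroid F' E,
          P.cocircuits τ' = HyperfieldMatroid.pushSet f (M.cocircuits τ) ↔ P = N) ∧
        (∀ (r : ℕ) (φ : (Fin r → E) → F), M.HasGP φ →
          HyperfieldMatroid.IsStrongGP (fun x => f.toFun (φ x)) ∧
          ∀ P : HyperfieldMatroid.StrongMatroid F' E,
            P.HasGP (fun x => f.toFun (φ x)) ↔ P = N) ∧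
        (∃ (M' : HyperfieldMatroid.StrongMatroid F E) (N' : HyperfieldMatroid.StrongMatroid F' E),
          M.IsDual τ M' ∧ N.IsDual τ' N' ∧
            N'.circuits = HyperfieldMatroid.pushSet f M'.circuits)) ∧
    (∀ M : HyperfieldMatroid.WeakMatroid F E,
      ∃ N : HyperfieldMatroid.WeakMatroid F' E,
        (∀ P : HyperfieldMatroid.WeakMatroid F' E,
          P.circuits = HyperfieldMatroid.pushSet f M.circuits ↔ P = N) ∧
        (∀ P : HyperfieldMatroid.WeakMatroid F' E,
          P.cocircuits τ' = HyperfieldMatroid.pushSet f (M.cocircuits τ) ↔ P = N) ∧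
        (∀ (r : ℕ) (φ : (Fin r → E) → F), M.HasGP φ →
          HyperfieldMatroid.IsWeakGP (fun x => f.toFun (φ x)) ∧
          ∀ P : HyperfieldMatroid.WeakMatroid F' E,
            P.HasGP (fun x => f.toFun (φ x)) ↔ P = N) ∧
        (∃ (M' : HyperfieldMatroid.WeakMatroid F E) (N' : HyperfieldMatroid.WeakMatroid F' E),
          M.IsDual τ M' ∧ N.IsDual τ' N' ∧
            N'.circuits = HyperfieldMatroid.pushSet f M'.circuits)) := by
  open HyperfieldMatroid in
  constructor
  · intro M
    obtain ⟨U, hM⟩ := M.exists_isDualPair τ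
    have hN := hM.map (τ' := τ') f hf
    let N : StrongMatroid F' E := ⟨pushSet f M.circuits, hN.isStrongCircuitSet⟩
    obtain ⟨UN, hN'⟩ := N.exists_isDualPair τ'
    have hco : N.cocircuits τ' = pushSet f (M.cocircuits τ) := hN'.right_unique hN le_top
    have hcirc : ∀ P : StrongMatroid F' E, P.circuits = pushSet f M.circuits ↔ P = N :=
      fun P => ⟨fun h => StrongMatroid.ext h, fun h => h ▸ rfl⟩
    refine ⟨N, hcirc, fun P => ⟨fun h => ?_, fun h => h ▸ hco⟩,
      fun r φ hφ => ⟨hφ.1.map f, fun P => ?_⟩,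
      ⟨M.cocircuits τ, hM.symm.isStrongCircuitSet⟩,
      ⟨pushSet f (M.cocircuits τ), hN.symm.isStrongCircuitSet⟩, rfl, hco.symm, rfl⟩
    · obtain ⟨UP, hP⟩ := P.exists_isDualPair τ'
      rw [h] at hP
      -- `P` and `N` share the cocircuit half of a dual pair, so their circuits agree.
      exact (hcirc P).1 (hP.left_unique hN le_top)
    · rw [← hcirc, StrongMatroid.HasGP, gpCircuits_map f hφ.1.isWeakGP, ← hφ.2,
        and_iff_right (hφ.1.map f)]
  · intro M
    obtain ⟨U, hM⟩ := M.exists_isDualPair τ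
    have hN := hM.map (τ' := τ') f hf
    have h23 : (2 : ℕ∞) ≤ 3 := by norm_num
    let N : WeakMatroid F' E := ⟨pushSet f M.circuits, hN.isWeakCircuitSet⟩
    obtain ⟨UN, hN'⟩ := N.exists_isDualPair τ'
    have hco : N.cocircuits τ' = pushSet f (M.cocircuits τ) := hN'.right_unique hN h23
    have hcirc : ∀ P : WeakMatroid F' E, P.circuits = pushSet f M.circuits ↔ P = N :=
      fun P => ⟨fun h => WeakMatroid.ext h, fun h => h ▸ rfl⟩
    refine ⟨N, hcirc, fun P => ⟨fun h => ?_, fun h => h ▸ hco⟩,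
      fun r φ hφ => ⟨hφ.1.map f, fun P => ?_⟩,
      ⟨M.cocircuits τ, hM.symm.isWeakCircuitSet⟩,
      ⟨pushSet f (M.cocircuits τ), hN.symm.isWeakCircuitSet⟩, rfl, hco.symm, rfl⟩
    · obtain ⟨UP, hP⟩ := P.exists_isDualPair τ'
      rw [h] at hP
      exact (hcirc P).1 (hP.left_unique hN h23)
    · rw [← hcirc, WeakMatroid.HasGP, gpCircuits_map f hφ.1, ← hφ.2,
        and_iff_right (hφ.1.map f)]
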